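/- **Setting.** Let $\alpha\in(0,1)$, let $d_{\rm core}\ge 1$ be an integer and let $\epsilon_{\rm core}\in(0,1/2)$ be such that $$\frac{j}{e^{\,j-\alpha}}\le \frac{\alpha}{8}\quad\text{for all integers } j\ge d_{\rm core},\qquad\qquad \ln \epsilon_{\rm core}^{-1}+\frac{\alpha}{8}>d_{\rm core}\,(1+\epsilon_{\rm core}).$$ (The choice $\epsilon_{\rm core}=e^{-d_{\rm core}+D(d_{\rm core})}$, for a positive function $D$ with $D(d)\to0$ as $d\to\infty$, satisfies these conditions once $d_{\rm core}$ is sufficiently large as a function of $\alpha$.) Let $L:\mathbb N\to\mathbb N$ be the failure threshold, for instance $L(n)=\lceil\log^{a} n\rceil$ with a constant $a>0$. **Algorithm.** For $n\ge 1$ and $n^{-1/4}\le \epsilon\le e^{-d_{\rm core}}$, the advanced bubble-up algorithm inserts distinct keys one after another into an initially empty table with $n$ slots, using independent uniformly random hashes $h_i(x)\in[n]$, for $1\le i\le d:=\lceil \ln\epsilon^{-1}+\alpha\rceil$. Let $\gamma = d \bmod d_{\rm core}$. The algorithm runs in phases $q=1,2,\dots,\lfloor d/d_{\rm core}\rfloor$;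 during phase $q$ put $d_{\max}=\gamma+q\,d_{\rm core}$, and the phase ends as soon as at least $(1-e^{-d_{\max}+\alpha})n$ keys have been inserted. Let $\mathrm{choice}(x)$ be the index $i$ of the hash $h_i(x)$ that key $x$ is using (for an evicted key, the index it was using when it was evicted; $0$ for a key not yet placed). A key $x$ is a *core element* if $\mathrm{choice}(x)\in\{d_{\max}-d_{\rm core}+1,\dots,d_{\max}\}$. A key $x$ that is being inserted or has just been evicted is placed as follows. * *Type 1 move.* If $x$ is a core element, then $x$ is put in slot $h_{d_{\max}-k+1}(x)$, for a fresh uniformly random $k\in\{1,\dots,d_{\rm core}\}$; a previous occupant of that slot is evicted and has to be placed next. * *Type 2 move.* If $x$ is not a core element, then the slots $h_i(x)$ with $\max(1,\mathrm{choice}(x)-d_{\rm core})\le i\le d_{\max}-d_{\rm core}$ are examined in increasing order of $i$, and $x$ is put in the first free one. If none of them is free, then $x$ becomes a core element and is put in slot $h_{d_{\max}-k+1}(x)$, for a fresh uniformly random $k\in\{1,\dots,d_{\rm core}\}$, evicting a previous occupant. * *Failure.* If a Type 1 move would have to be made directly after $L(n)$ Type 1 moves in a row in the same insertion, then failure is declared;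 the algorithm stops, and the current phase is said to have ended. **Proposition.** With high probability in $n$, at the end of every phase the number of core elements is at most $(1-\epsilon_{\rm core})n$. That is: for every constant $c>0$ there is a constant $C$, which depends only on $c,\alpha,d_{\rm core},\epsilon_{\rm core}$ and the function $L$, such that for all $n\ge1$ and all $\epsilon$ with $n^{-1/4}\le\epsilon\le e^{-d_{\rm core}}$, with probability at least $1-C/n^{c}$ the number of core elements is at most $(1-\epsilon_{\rm core})n$ at the end of every phase that the algorithm reaches (including a phase ended by a failure). -/

import Mathlib

open MeasureTheory ProbabilityTheory

namespace BubbleUp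

/-- The number of hash functions `d = ⌈ln ε⁻¹ + α⌉`. -/
noncomputable def numHashes (α ε : ℝ) : ℕ := ⌈Real.log ε⁻¹ + α⌉₊

/-- `γ = ⌈ln ε⁻¹ + α⌉ mod d_core`. -/
noncomputable def gam (α ε : ℝ) (dcore : ℕ) : ℕ := numHashes α ε % dcore

/-- The value `d_max = γ + q d_core` that is in force during phase `q`. -/
noncomputable def dMax (α ε : ℝ) (dcore q : ℕ) : ℕ := gam α ε dcore + q * dcore

/-- The index of the final phase, the one with `d_max = ⌈ln ε⁻¹ + α⌉`. Phases are numbered from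
`1`. -/
noncomputable def lastPhase (α ε : ℝ) (dcore : ℕ) : ℕ := numHashes α ε / dcore

/-- Phase `q` ends as soon as the number of keys is at least `(1 - e^(-d_max + α)) n`. -/
noncomputable def target (n : ℕ) (α ε : ℝ) (dcore q : ℕ) : ℕ :=
  ⌈(1 - Real.exp (-(dMax α ε dcore q : ℝ) + α)) * n⌉₊

/-- State of the algorithm on a table with `n` slots. The keys are named `0, 1, 2, …` in the order
in which they are inserted. -/
structure State (n : ℕ) where
  /-- the content of each slot (`none` is a free slot) -/
  table : Fin n → Option ℕ
  /-- the index of the hash function that a key uses; `0` for a key not yet placed, and for a key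
  that has just been evicted the index it was using when it was evicted -/
  choice : ℕ → ℕ
  /-- the key which is being inserted or has been evicted, and is waiting for a slot -/
  hand : Option ℕ
  /-- the number of keys whose insertion has been started -/
  count : ℕ
  /-- the current phase -/
  phase : ℕ
  /-- the number of consecutive Type 1 moves made so far in the current insertion -/
  streak : ℕ
  /-- whether failure has been declared -/
  failed : Bool

/-- The empty table at the beginning of phase `1`. -/
def State.init (n : ℕ) : State n where
  table := fun _ => none
  choice := fun _ => 0
  hand := none
  count := 0
  phase := 1
  streak := 0
  failed := false

variable {n : ℕ}

/-- Key `x` is a core element: `choice x ∈ (d_max - d_core, d_max]`, where `d_max` is the current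
value. -/
def State.IsCore (s : State n) (α ε : ℝ) (dcore x : ℕ) : Prop :=
  dMax α ε dcore s.phase - dcore < s.choice x ∧ s.choice x ≤ dMax α ε dcore s.phase

noncomputable instance (s : State n) (α ε : ℝ) (dcore x : ℕ) :
    Decidable (s.IsCore α ε dcore x) := by
  unfold State.IsCore; infer_instance

/-- The number of core elements. -/
noncomputable def State.coreCount (s : State n) (α ε : ℝ) (dcore : ℕ) : ℕ :=
  ((Finset.range s.count).filter (fun x => s.IsCore α ε dcore x)).card

/-- Put `x` in the slot `h x i`; a previous occupant of that slot is evicted. -/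
def State.place (s : State n) (h : ℕ → ℕ → Fin n) (x i : ℕ) : State n :=
  { s with
    table := Function.update s.table (h x i) (some x)
    choice := Function.update s.choice x i
    hand := s.table (h x i) }

/-- The indices `i` with `max 1 (choice x - d_core) ≤ i ≤ d_max - d_core` for which the slot
`h x i` is free. -/
noncomputable def State.freeIndices (s : State n) (α ε : ℝ) (dcore : ℕ) (h : ℕ → ℕ → Fin n)
    (x : ℕ) : Finset ℕ :=
  (Finset.Icc (max 1 (s.choice x - dcore)) (dMax α ε dcore s.phase - dcore)).filter
    (fun i => s.table (h x i) = none)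

/-- One move for the key `x` in hand. The random number `k ∈ {0, …, d_core - 1}` is used when `x`
is placed as a core element, in slot `h x (d_max - k)`.

* A core element makes a Type 1 move, except that failure is declared if it would come after `L`
  Type 1 moves in a row.
* Another key makes a Type 2 move: it takes the first free slot among the examined ones, and
  becomes a core element if there is none. -/
noncomputable def State.move (s : State n) (α ε : ℝ) (dcore L : ℕ) (h : ℕ → ℕ → Fin n)
    (k x : ℕ) : State n :=
  if s.IsCore α ε dcore x then
    if s.streak < L then
      { s.place h x (dMax α ε dcore s.phase - k) with streak := s.streak + 1 }
    else { s with failed := true }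
  else
    if hf : (s.freeIndices α ε dcore h x).Nonempty then
      { s.place h x ((s.freeIndices α ε dcore h x).min' hf) with streak := 0 }
    else
      { s.place h x (dMax α ε dcore s.phase - k) with streak := 0 }

/-- No insertion is in progress and the load factor that ends the current phase has been
reached. -/
def State.PhaseComplete (s : State n) (α ε : ℝ) (dcore : ℕ) : Prop :=
  s.hand = none ∧ target n α ε dcore s.phase ≤ s.count

noncomputable instance (s : State n) (α ε : ℝ) (dcore : ℕ) :
    Decidable (s.PhaseComplete α ε dcore) := by
  unfold State.PhaseComplete; infer_instance

/-- One step of the algorithm: nothing happens after a failure; a key in hand makes a move; if no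
key is in hand, then the next phase begins if the current one is complete (the algorithm stops
after the last one), and otherwise the insertion of the next key begins. -/
noncomputable def State.step (s : State n) (α ε : ℝ) (dcore L : ℕ) (h : ℕ → ℕ → Fin n)
    (k : ℕ) : State n :=
  if s.failed = true then s
  else
    match s.hand with
    | some x => s.move α ε dcore L h k x
    | none =>
      if s.PhaseComplete α ε dcore then
        if s.phase < lastPhase α ε dcore then { s with phase := s.phase + 1 } else s
      else { s with hand := some s.count, count := s.count + 1, streak := 0 }

/-- The current phase is at its end: it is complete, or it has been ended by a failure. -/
def State.AtPhaseEnd (s : State n) (α ε : ℝ) (dcore : ℕ) : Prop :=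
  s.failed = true ∨ s.PhaseComplete α ε dcore

/-- Sample space: the hash functions (`h x i` is the `i`-th hash of the key `x`), and the random
numbers in `{0, …, d_core - 1}` that are available to the successive steps. -/
abbrev Sample (n dcore : ℕ) : Type := (ℕ × ℕ → Fin n) × (ℕ → Fin dcore)

/-- All hashes and all random choices are independent and uniform. -/
noncomputable def law (n dcore : ℕ) [NeZero n] [NeZero dcore] : Measure (Sample n dcore) :=
  (Measure.infinitePi (fun _ : ℕ × ℕ => uniformOn (Set.univ : Set (Fin n)))).prod
    (Measure.infinitePi (fun _ : ℕ => uniformOn (Set.univ : Set (Fin dcore))))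

/-- The state after `t` steps. -/
noncomputable def run {n dcore : ℕ} (α ε : ℝ) (L : ℕ) (ω : Sample n dcore) : ℕ → State n
  | 0 => State.init n
  | t + 1 => (run α ε L ω t).step α ε dcore L (fun x i => ω.1 (x, i)) (ω.2 t)

end BubbleUp

/-! The hashes are revealed by deferred decisions: `h (x, i)` is drawn when it is first examined and
is then uniform given the past. The random numbers `k` can be fixed arbitrarily beforehand. A slot
never becomes free again, so it is occupied exactly when some examined hash points to it, and after
m distinct examinations about n·e^(-m/n) slots are free. While d_max = D, the number of keys is at
most the target of the phase, so about e^(-D+α)·n slots or more are free and at most about (D-α)n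
pairs (x, i) have been examined.

Let J = D - d_core, and let P be the number of examined pairs with index beyond J. Every core
element, except possibly the one in hand, occupies a slot hit by such a pair, and about n·e^(-P/n)
slots are not hit. So it suffices that P is at most about (d_core - α/2)n, because ε_core <
e^(-d_core+α/8).

To bound P, give each slot as weight the number of unexamined hashes among the first J of its
occupant (J if it is free). Double counting gives Jn + P ≤ (total weight) + (number of examined
pairs), see `Micro.Inv.mul_add_card_le`. A slot hit in the core has weight 0 from then on, and the
weight of any other slot is at most its weight at the start of the phase. The initial total is at
most d_core·n, since the previous phase cannot fill the table with only (J - d_core)n examinations.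
Each core examination hits a uniform slot, so after (d_core - α/2)n of them the surviving weight is
at most about (d_core/e^(d_core-α))n ≤ αn/8. A larger P would contradict the bound (D-α)n on all
examinations.

These four concentration claims per phase are proved with exponential supermartingales
(`sum_upPot_le`, `sum_loPot_le`), added up to one potential and fed into the Ville inequality
`explore_hit_le`. The deviations are of order n^(3/4), as ε ≥ n^(-1/4), and the exponential rates
are of order 1/log² n, so the failure probability is superpolynomially small. The bound on the core
holds at every time, hence at phase ends. -/

namespace BubbleUp

/-! ### Deferred decisions and a Ville inequality for explorations -/

/-- One step of an exploration: the state either asks for one value of `h` or moves silently. -/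
def exploreStep {S ι V K : Type*} (query : S → K → Option ι) (silent : S → K → S)
    (next : S → K → V → S) (idx : S → ℕ) (h : ι → V) (κ : ℕ → K) (s : S) : S :=
  match query s (κ (idx s)) with
  | none => silent s (κ (idx s))
  | some p => next s (κ (idx s)) (h p)

/-- The state of an exploration after the given number of steps. -/
def explore {S ι V K : Type*} (query : S → K → Option ι) (silent : S → K → S)
    (next : S → K → V → S) (idx : S → ℕ) (h : ι → V) (κ : ℕ → K) : ℕ → S → S
  | 0, s => s
  | T + 1, s => explore query silent next idx h κ T (exploreStep query silent next idx h κ s)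

theorem explore_succ' {S ι V K : Type*} (query : S → K → Option ι) (silent : S → K → S)
    (next : S → K → V → S) (idx : S → ℕ) (h : ι → V) (κ : ℕ → K) (T : ℕ) (s : S) :
    explore query silent next idx h κ (T + 1) s =
      exploreStep query silent next idx h κ (explore query silent next idx h κ T s) := by
  induction T generalizing s with
  | zero => rfl
  | succ T ih => rw [explore, ih]; rfl

/-- The state space carries no σ-algebra. Each step reads at most one hash and one random number,
both with finitely many values, so the event splits into finitely many cylinder pieces. -/
theorem measurableSet_explore {S ι V K : Type*} [MeasurableSpace V] [MeasurableSpace K]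
    [Finite V] [Finite K] [MeasurableSingletonClass V] [MeasurableSingletonClass K]
    (query : S → K → Option ι) (silent : S → K → S)
    (next : S → K → V → S) (idx : S → ℕ) (B : Set S) (T : ℕ) (s : S) :
    MeasurableSet {ω : (ι → V) × (ℕ → K) | explore query silent next idx ω.1 ω.2 T s ∈ B} := by
  induction T generalizing s with
  | zero => simp only [explore]; exact MeasurableSet.const _
  | succ T ih =>
    have key : {ω : (ι → V) × (ℕ → K) | explore query silent next idx ω.1 ω.2 (T + 1) s ∈ B} =
        ⋃ k : K, {ω | ω.2 (idx s) = k} ∩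
          (match query s k with
          | none => {ω | explore query silent next idx ω.1 ω.2 T (silent s k) ∈ B}
          | some p => ⋃ v : V, {ω | ω.1 p = v} ∩
              {ω | explore query silent next idx ω.1 ω.2 T (next s k v) ∈ B}) := by
      ext ω
      simp only [Set.mem_ofPred_eq, Set.mem_iUnion, Set.mem_inter_iff]
      rw [explore, exploreStep]
      constructor
      · intro hω
        refine ⟨_, rfl, ?_⟩
        cases hq : query s (ω.2 (idx s)) with
        | none => simpa [hq] using hω
        | some p => simpa [hq] using hω
      · rintro ⟨k, rfl, hk⟩
        cases hq : query s (ω.2 (idx s)) with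
        | none => simpa [hq] using hk
        | some p => simpa [hq] using hk
    rw [key]
    refine MeasurableSet.iUnion fun k => MeasurableSet.inter ?_ ?_
    · exact measurableSet_eq_fun ((measurable_pi_apply (idx s)).comp measurable_snd) measurable_const
    · cases query s k with
      | none => exact ih _
      | some p =>
        refine MeasurableSet.iUnion fun v => MeasurableSet.inter ?_ (ih _)
        exact measurableSet_eq_fun ((measurable_pi_apply p).comp measurable_fst) measurable_const

theorem lintegral_uniformOn_univ {V : Type*} [Fintype V] [Nonempty V] [MeasurableSpace V]
    [MeasurableSingletonClass V] (f : V → ENNReal) :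
    ∫⁻ v, f v ∂(uniformOn (Set.univ : Set V)) = (∑ v, f v) / Fintype.card V := by
  rw [lintegral_fintype, ENNReal.div_eq_inv_mul, Finset.mul_sum]
  refine Finset.sum_congr rfl fun v _ => ?_
  rw [uniformOn_univ, Measure.count_singleton, mul_comm, one_div]

/-- Both measures agree on finite boxes, where the new value simply takes the place of the factor at
`p`. This is the formal content of drawing a coordinate only when it is needed. -/
theorem infinitePi_resample {ι V : Type*} [DecidableEq ι] [MeasurableSpace V] (μ : Measure V)
    [IsProbabilityMeasure μ] (p : ι) :
    (μ.prod (Measure.infinitePi (fun _ : ι => μ))).map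
      (fun z : V × (ι → V) => Function.update z.2 p z.1) =
      Measure.infinitePi (fun _ : ι => μ) := by
  have hm : Measurable (fun z : V × (ι → V) => Function.update z.2 p z.1) := by
    rw [measurable_pi_iff]
    intro i
    by_cases hi : i = p
    · subst hi; simpa using measurable_fst
    · simp only [Function.update_of_ne hi]; fun_prop
  refine Measure.eq_infinitePi _ fun s t ht => ?_
  rw [Measure.map_apply hm (MeasurableSet.pi s.countable_toSet fun i _ => ht i)]
  by_cases hp : p ∈ s
  · have : (fun z : V × (ι → V) => Function.update z.2 p z.1) ⁻¹' (s : Set ι).pi t =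
        t p ×ˢ ((s.erase p : Finset ι) : Set ι).pi t := by
      ext z
      simp only [Set.mem_preimage, Set.mem_pi, Finset.mem_coe, Set.mem_prod, Finset.mem_erase]
      constructor
      · intro hz
        refine ⟨by simpa using hz p hp, fun i hi => by simpa [hi.1] using hz i hi.2⟩
      · rintro ⟨h1, h2⟩ i hi
        by_cases hip : i = p
        · subst hip; simpa using h1
        · simpa [hip] using h2 i ⟨hip, hi⟩
    rw [this, Measure.prod_prod, Measure.infinitePi_pi _ fun i _ => ht i,
      Finset.mul_prod_erase s (fun i => μ (t i)) hp]
  · have : (fun z : V × (ι → V) => Function.update z.2 p z.1) ⁻¹' (s : Set ι).pi t =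
        Set.univ ×ˢ (s : Set ι).pi t := by
      ext z
      simp only [Set.mem_preimage, Set.mem_pi, Finset.mem_coe, Set.mem_prod, Set.mem_univ, true_and]
      refine forall₂_congr fun i hi => ?_
      have hip : i ≠ p := fun h => hp (h ▸ hi)
      simp [hip]
    rw [this, Measure.prod_prod, Measure.infinitePi_pi _ fun i _ => ht i, measure_univ, one_mul]

theorem infinitePi_uniform_resample {ι V : Type*} [DecidableEq ι] [Fintype V] [Nonempty V]
    [MeasurableSpace V] [MeasurableSingletonClass V] (p : ι) (B : Set (ι → V))
    (hB : MeasurableSet B) :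
    Measure.infinitePi (fun _ : ι => uniformOn (Set.univ : Set V)) B =
      (∑ v, Measure.infinitePi (fun _ : ι => uniformOn (Set.univ : Set V))
        {h | Function.update h p v ∈ B}) / Fintype.card V := by
  have hm : Measurable (fun z : V × (ι → V) => Function.update z.2 p z.1) := by
    rw [measurable_pi_iff]
    intro i
    by_cases hi : i = p
    · subst hi; simpa using measurable_fst
    · simp only [Function.update_of_ne hi]; fun_prop
  conv_lhs => rw [← infinitePi_resample _ p]
  rw [Measure.map_apply hm hB, Measure.prod_apply (hm hB), lintegral_uniformOn_univ]
  rfl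

/-- A Ville type inequality: an exploration of uniformly random values with memory `(R, g)` whose
potential does not increase in expectation rarely reaches a state of potential at least `1`. -/
theorem explore_hit_le {S ι V K : Type*} [DecidableEq ι] [Fintype V] [Nonempty V]
    [MeasurableSpace V] [MeasurableSingletonClass V]
    (query : S → K → Option ι) (silent : S → K → S) (next : S → K → V → S) (idx : S → ℕ)
    (R : S → Finset ι) (g : S → ι → V) (Inv Bad : S → Prop) (Φ : S → ENNReal) (κ : ℕ → K)
    (hRs : ∀ s k, query s k = none → R (silent s k) = R s ∧ g (silent s k) = g s)
    (hRn : ∀ s k p v, query s k = some p →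
      R (next s k v) = insert p (R s) ∧ g (next s k v) = Function.update (g s) p v)
    (hBad : ∀ s, Inv s → Bad s → 1 ≤ Φ s)
    (hIs : ∀ s k, Inv s → query s k = none → Inv (silent s k))
    (hIn : ∀ s k p v, Inv s → query s k = some p → (p ∈ R s → v = g s p) → Inv (next s k v))
    (hΦs : ∀ s k, Inv s → ¬ Bad s → query s k = none → Φ (silent s k) ≤ Φ s)
    (hΦk : ∀ s k p, Inv s → ¬ Bad s → query s k = some p → p ∈ R s →
      Φ (next s k (g s p)) ≤ Φ s)
    (hΦn : ∀ s k p, Inv s → ¬ Bad s → query s k = some p → p ∉ R s →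
      (∑ v, Φ (next s k v)) / Fintype.card V ≤ Φ s)
    (hmeas : ∀ (B : Set S) (T : ℕ) (s : S),
      MeasurableSet {h : ι → V | explore query silent next idx h κ T s ∈ B})
    (T : ℕ) (s : S) (hs : Inv s) :
    Measure.infinitePi (fun _ : ι => uniformOn (Set.univ : Set V))
      {h | ∃ t ≤ T, Bad (explore query silent next idx ((R s).piecewise (g s) h) κ t s)} ≤ Φ s := by
  have hpm : ∀ s : S, Measurable (fun h : ι → V => (R s).piecewise (g s) h) := by
    intro s
    rw [measurable_pi_iff]
    intro i
    by_cases hi : i ∈ R s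
    · simp [Finset.piecewise, hi]
    · simp only [Finset.piecewise, hi, if_false]; fun_prop
  have hmeas' : ∀ (T : ℕ) (s s' : S), MeasurableSet
      {h : ι → V | ∃ t ≤ T, Bad (explore query silent next idx ((R s).piecewise (g s) h) κ t s')} := by
    intro T s s'
    have : {h : ι → V | ∃ t ≤ T,
        Bad (explore query silent next idx ((R s).piecewise (g s) h) κ t s')} =
        ⋃ t ∈ Finset.range (T + 1), (fun h : ι → V => (R s).piecewise (g s) h) ⁻¹'
          {h | explore query silent next idx h κ t s' ∈ {x | Bad x}} := by
      ext h; simp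
    rw [this]
    exact Finset.measurableSet_biUnion _ fun t _ => hpm s (hmeas _ _ _)
  induction T generalizing s with
  | zero =>
    by_cases hb : Bad s
    · exact prob_le_one.trans (hBad s hs hb)
    · simp [explore, hb]
  | succ T ih =>
    by_cases hb : Bad s
    · exact prob_le_one.trans (hBad s hs hb)
    -- The induction peels off the first step, so that the hypothesis applies to the state after it.
    have hshift : ∀ h : ι → V, (∃ t ≤ T + 1, Bad (explore query silent next idx h κ t s)) ↔
        ∃ t ≤ T, Bad (explore query silent next idx h κ t
          (exploreStep query silent next idx h κ s)) := by
      intro h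
      constructor
      · rintro ⟨t, ht, hB⟩
        cases t with
        | zero => exact absurd hB hb
        | succ t => exact ⟨t, by omega, hB⟩
      · rintro ⟨t, ht, hB⟩
        exact ⟨t + 1, by omega, hB⟩
    set k := κ (idx s) with hk
    cases hq : query s k with
    | none =>
      refine le_trans (le_of_eq ?_) ((ih (silent s k) (hIs s k hs hq)).trans (hΦs s k hs hb hq))
      congr 1
      ext h
      rw [Set.mem_ofPred_eq, Set.mem_ofPred_eq, hshift, exploreStep, ← hk, hq, (hRs s k hq).1,
        (hRs s k hq).2]
    | some p =>
      by_cases hp : p ∈ R s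
      · have hR := hRn s k p (g s p) hq
        rw [Finset.insert_eq_of_mem hp, Function.update_eq_self] at hR
        refine le_trans (le_of_eq ?_) ((ih (next s k (g s p))
          (hIn s k p _ hs hq fun _ => rfl)).trans (hΦk s k p hs hb hq hp))
        congr 1
        ext h
        rw [Set.mem_ofPred_eq, Set.mem_ofPred_eq, hshift, exploreStep, ← hk, hq, hR.1, hR.2]
        simp [Finset.piecewise, hp]
      · refine le_trans ?_ (hΦn s k p hs hb hq hp)
        -- A fresh coordinate is averaged over its values `v`; the induction hypothesis applies for
        -- each `v` separately.
        rw [infinitePi_uniform_resample p _ (hmeas' (T + 1) s s)]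
        gcongr with v
        refine le_trans (le_of_eq ?_) (ih (next s k v) (hIn s k p v hs hq fun h => absurd h hp))
        congr 1
        ext h
        have hR := hRn s k p v hq
        -- Fixing the coordinate `p` to `v` is the same as storing `v` in the memory of the next
        -- state.
        have e : (R s).piecewise (g s) (Function.update h p v) =
            (R (next s k v)).piecewise (g (next s k v)) h := by
          rw [hR.1, hR.2]
          ext i
          by_cases hi : i = p
          · subst hi; simp [Finset.piecewise, hp]
          · simp [Finset.piecewise, hi]
        rw [Set.mem_ofPred_eq, Set.mem_ofPred_eq, Set.mem_ofPred_eq, hshift, exploreStep, ← hk, hq, e]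
        have : (R (next s k v)).piecewise (g (next s k v)) h p = v := by
          rw [hR.1, hR.2]; simp [Finset.piecewise]
        simp only [this]

/-! ### Exponential supermartingales for uniform probes -/

/-- Exponential potential controlling the upper tail of a weight `X` that has survived `m` of `M`
uniform probes. -/
noncomputable def upPot (lam rho a : ℝ) (M m : ℕ) (X : ℝ) : ℝ :=
  Real.exp (lam * (rho ^ (M - m) * X - a))

/-- Exponential potential controlling the lower tail of a weight `X` that has survived `m ≤ M`
uniform probes. -/
noncomputable def loPot (lam rho b : ℝ) (M m : ℕ) (X : ℝ) : ℝ :=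
  if m ≤ M then Real.exp (lam * (b - rho ^ (M - m) * X)) else 0

theorem upPot_nonneg (lam rho a : ℝ) (M m : ℕ) (X : ℝ) : 0 ≤ upPot lam rho a M m X :=
  (Real.exp_pos _).le

theorem loPot_nonneg (lam rho b : ℝ) (M m : ℕ) (X : ℝ) : 0 ≤ loPot lam rho b M m X := by
  unfold loPot; split_ifs
  · exact (Real.exp_pos _).le
  · exact le_rfl

theorem exp_neg_le_linear {x η : ℝ} (h0 : 0 ≤ x) (hx : x ≤ η) (hη : η ≤ 1) :
    Real.exp (-x) ≤ 1 - (1 - η) * x := by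
  have := Real.abs_exp_sub_one_sub_id_le (x := -x) (by rw [abs_neg, abs_of_nonneg h0]; linarith)
  have := (abs_le.1 this).2
  nlinarith

theorem exp_le_linear {x η : ℝ} (h0 : 0 ≤ x) (hx : x ≤ η) (hη : η ≤ 1) :
    Real.exp x ≤ 1 + (1 + η) * x := by
  have := Real.abs_exp_sub_one_sub_id_le (x := x) (by rw [abs_of_nonneg h0]; linarith)
  have := (abs_le.1 this).2
  nlinarith

/-- A uniform probe removes on average the fraction 1/n of the weight. As each exponent is at most
η, e^(-x) ≤ 1 - (1-η)x turns this into the factor 1 - (1-η)/n. After `M` probes the truncated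
exponent `M - m` stays 0 and the potential decreases because the weight does. -/
theorem sum_upPot_le {n : ℕ} (hn : 1 ≤ n) {lam η B : ℝ} (a : ℝ) (hlam : 0 ≤ lam) (hη0 : 0 ≤ η)
    (hη : η ≤ 1) (hB : lam * B ≤ η) (w : Fin n → ℝ) (hw0 : ∀ s, 0 ≤ w s) (hwB : ∀ s, w s ≤ B)
    (M m : ℕ) (A : Finset (Fin n)) :
    ∑ v, upPot lam (1 - (1 - η) / n) a M (m + 1) (∑ s ∈ A.erase v, w s) ≤
      n * upPot lam (1 - (1 - η) / n) a M m (∑ s ∈ A, w s) := by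
  have hnR : (1 : ℝ) ≤ n := by exact_mod_cast hn
  set ρ : ℝ := 1 - (1 - η) / n with hρ
  have hρ0 : 0 ≤ ρ := by
    have : (1 - η) / n ≤ 1 := (div_le_one (by linarith)).2 (by linarith)
    linarith
  have hρ1 : ρ ≤ 1 := by
    have : 0 ≤ (1 - η) / n := div_nonneg (by linarith) (by linarith)
    linarith
  by_cases hm : m < M
  · obtain ⟨e, he⟩ : ∃ e, M - m = e + 1 := ⟨M - m - 1, by omega⟩
    have he' : M - (m + 1) = e := by omega
    unfold upPot
    rw [he, he']
    set X : ℝ := lam * (ρ ^ e * ∑ s ∈ A, w s) with hX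
    set x : Fin n → ℝ := fun v => lam * (ρ ^ e * w v) with hx
    have hpe0 : 0 ≤ ρ ^ e := pow_nonneg hρ0 e
    have hpe1 : ρ ^ e ≤ 1 := pow_le_one₀ hρ0 hρ1
    have hx0 : ∀ v, 0 ≤ x v := fun v => mul_nonneg hlam (mul_nonneg hpe0 (hw0 v))
    have hx1 : ∀ v, x v ≤ η := fun v => by
      refine le_trans (mul_le_mul_of_nonneg_left ?_ hlam) hB
      calc ρ ^ e * w v ≤ 1 * w v := mul_le_mul_of_nonneg_right hpe1 (hw0 v)
        _ ≤ B := by rw [one_mul]; exact hwB v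
    have hXs : X = ∑ s ∈ A, x s := by rw [hX, Finset.mul_sum, Finset.mul_sum]
    have hterm : ∀ v, Real.exp (lam * (ρ ^ e * ∑ s ∈ A.erase v, w s - a)) ≤
        Real.exp (X - lam * a) * (1 - (1 - η) * (if v ∈ A then x v else 0)) := by
      intro v
      by_cases hv : v ∈ A
      · have h1 : ∑ s ∈ A.erase v, w s = ∑ s ∈ A, w s - w v := by
          rw [← Finset.add_sum_erase A w hv]; ring
        have h2 : lam * (ρ ^ e * ∑ s ∈ A.erase v, w s - a) = (X - lam * a) + (-x v) := by
          rw [h1]; simp only [hX, hx]; ring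
        rw [h2, Real.exp_add, if_pos hv]
        exact mul_le_mul_of_nonneg_left (exp_neg_le_linear (hx0 v) (hx1 v) hη)
          (Real.exp_pos _).le
      · rw [Finset.erase_eq_of_notMem hv, if_neg hv, mul_zero, sub_zero, mul_one]
        apply le_of_eq; congr 1; rw [hX]; ring
    refine (Finset.sum_le_sum fun v _ => hterm v).trans ?_
    rw [← Finset.mul_sum, Finset.sum_sub_distrib, ← Finset.mul_sum, Finset.sum_ite_mem,
      Finset.univ_inter, ← hXs]
    simp only [Finset.sum_const, Finset.card_univ, Fintype.card_fin, nsmul_eq_mul, mul_one]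
    -- The extra factor ρ on the right supplies exactly the term -(1-η)X/n; then 1 + t ≤ e^t
    -- suffices.
    have h3 : lam * (ρ ^ (e + 1) * ∑ s ∈ A, w s - a) = (X - lam * a) + (-((1 - η) * X / n)) := by
      rw [hX, pow_succ]
      have : ρ = 1 - (1 - η) / n := hρ
      nth_rewrite 2 [this]
      ring
    rw [h3, Real.exp_add]
    have h4 := Real.add_one_le_exp (-((1 - η) * X / n))
    have h5 : (n : ℝ) - (1 - η) * X = n * (-((1 - η) * X / n) + 1) := by
      field_simp; ring
    rw [h5]
    calc Real.exp (X - lam * a) * (n * (-((1 - η) * X / n) + 1))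
        = n * (Real.exp (X - lam * a) * (-((1 - η) * X / n) + 1)) := by ring
      _ ≤ _ := by gcongr
  · have h1 : M - (m + 1) = 0 := by omega
    have h2 : M - m = 0 := by omega
    unfold upPot
    rw [h1, h2]
    calc _ ≤ ∑ v : Fin n, Real.exp (lam * (ρ ^ 0 * ∑ s ∈ A, w s - a)) := by
          refine Finset.sum_le_sum fun v _ => ?_
          gcongr
          · exact fun s _ _ => hw0 s
          · exact Finset.erase_subset _ _
      _ = _ := by simp

/-- The counterpart with e^x ≤ 1 + (1+η)x. The potential is set to 0 after `M` probes, since the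
lower tail is only needed up to then; `2 ≤ n` keeps the decay factor nonnegative. -/
theorem sum_loPot_le {n : ℕ} (hn : 2 ≤ n) {η : ℝ} (b : ℝ) (hη0 : 0 ≤ η) (hη : η ≤ 1)
    (M m : ℕ) (A : Finset (Fin n)) :
    ∑ v, loPot η (1 - (1 + η) / n) b M (m + 1) (A.erase v).card ≤
      n * loPot η (1 - (1 + η) / n) b M m A.card := by
  have hnR : (2 : ℝ) ≤ n := by exact_mod_cast hn
  set ρ : ℝ := 1 - (1 + η) / n with hρ
  have hρ0 : 0 ≤ ρ := by
    have : (1 + η) / n ≤ 1 := (div_le_one (by linarith)).2 (by linarith)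
    linarith
  have hρ1 : ρ ≤ 1 := by
    have : 0 ≤ (1 + η) / n := div_nonneg (by linarith) (by linarith)
    linarith
  by_cases hm : m < M
  · obtain ⟨e, he⟩ : ∃ e, M - m = e + 1 := ⟨M - m - 1, by omega⟩
    have he' : M - (m + 1) = e := by omega
    unfold loPot
    rw [he, he', if_pos hm.le]
    simp only [if_pos (Nat.succ_le_of_lt hm)]
    set y : ℝ := η * ρ ^ e with hy
    have hpe0 : 0 ≤ ρ ^ e := pow_nonneg hρ0 e
    have hpe1 : ρ ^ e ≤ 1 := pow_le_one₀ hρ0 hρ1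
    have hy0 : 0 ≤ y := mul_nonneg hη0 hpe0
    have hy1 : y ≤ η := by
      calc y ≤ η * 1 := mul_le_mul_of_nonneg_left hpe1 hη0
        _ = η := mul_one _
    set E := Real.exp (η * b - y * A.card) with hE
    have hterm : ∀ v, Real.exp (η * (b - ρ ^ e * (A.erase v).card)) ≤
        E * (1 + if v ∈ A then (1 + η) * y else 0) := by
      intro v
      by_cases hv : v ∈ A
      · have h1 : ((A.erase v).card : ℝ) = A.card - 1 := by
          rw [Finset.card_erase_of_mem hv, Nat.cast_sub (Finset.card_pos.2 ⟨v, hv⟩)]; simp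
        have h2 : η * (b - ρ ^ e * (A.erase v).card) = (η * b - y * A.card) + y := by
          rw [h1, hy]; ring
        rw [h2, Real.exp_add, if_pos hv]
        exact mul_le_mul_of_nonneg_left (exp_le_linear hy0 hy1 hη) (Real.exp_pos _).le
      · rw [Finset.erase_eq_of_notMem hv, if_neg hv, add_zero, mul_one]
        apply le_of_eq; rw [hE]; congr 1; rw [hy]; ring
    refine (Finset.sum_le_sum fun v _ => hterm v).trans ?_
    rw [← Finset.mul_sum, Finset.sum_add_distrib, Finset.sum_ite_mem, Finset.univ_inter]
    simp only [Finset.sum_const, Finset.card_univ, Fintype.card_fin, nsmul_eq_mul, mul_one]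
    have h3 : η * (b - ρ ^ (e + 1) * A.card) =
        (η * b - y * A.card) + A.card * ((1 + η) * y) / n := by
      rw [hy, pow_succ]
      have : ρ = 1 - (1 + η) / n := hρ
      nth_rewrite 2 [this]
      ring
    rw [h3, Real.exp_add]
    have h4 := Real.add_one_le_exp (A.card * ((1 + η) * y) / n)
    have h5 : (n : ℝ) + A.card * ((1 + η) * y) = n * (A.card * ((1 + η) * y) / n + 1) := by
      field_simp; ring
    rw [h5]
    calc E * (n * (A.card * ((1 + η) * y) / n + 1))
        = n * (E * (A.card * ((1 + η) * y) / n + 1)) := by ring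
      _ ≤ _ := by gcongr
  · have h1 : ¬ (m + 1 ≤ M) := by omega
    have : ∀ X, loPot η ρ b M (m + 1) X = 0 := fun X => by unfold loPot; rw [if_neg h1]
    simp only [this, Finset.sum_const_zero]
    exact mul_nonneg (by linarith) (loPot_nonneg _ _ _ _ _ _)

/-! ### The algorithm with slots examined one at a time -/

variable {n : ℕ}

/-- The number `d_max - d_core` of hashes that a key examines before it becomes a core element. -/
noncomputable def preDepth (α ε : ℝ) (dcore q : ℕ) : ℕ := dMax α ε dcore q - dcore

/-- Put `x` in the slot `v`, which is its `i`-th hash. -/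
def State.placeAt (s : State n) (x i : ℕ) (v : Fin n) : State n :=
  { s with
    table := Function.update s.table v (some x)
    choice := Function.update s.choice x i
    hand := s.table v }

/-- The state of the algorithm when the slots are examined one at a time. -/
structure Micro (n : ℕ) where
  /-- the state after the last completed step -/
  st : State n
  /-- a lower bound for the next index to be examined in the current step -/
  scan : ℕ
  /-- the number of completed steps -/
  time : ℕ
  /-- the pairs `(x, i)` for which `h x i` has been examined -/
  seen : Finset (ℕ × ℕ)
  /-- the hashes that have been examined -/
  val : ℕ × ℕ → Fin n
  /-- the weight that each slot had at the beginning of the current phase -/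
  wt : Fin n → ℕ

/-- The weight of a slot with respect to the depth `J`: the number of the first `J` hashes of its
occupant that have not been examined yet, and `J` for a free slot. -/
def weight (J : ℕ) (table : Fin n → Option ℕ) (seen : Finset (ℕ × ℕ)) (s : Fin n) : ℕ :=
  match table s with
  | none => J
  | some x => ((Finset.Icc 1 J).filter fun i => (x, i) ∉ seen).card

/-- The next index to be examined for the key `x` if it is not a core element. -/
def Micro.cur (μ : Micro n) (dcore x : ℕ) : ℕ :=
  max (max 1 (μ.st.choice x - dcore)) μ.scan

/-- The hash to be examined next. -/
noncomputable def microQuery {dcore : ℕ} (α ε : ℝ) (L : ℕ) (μ : Micro n) (k : Fin dcore) :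
    Option (ℕ × ℕ) :=
  if μ.st.failed = true then none
  else
    match μ.st.hand with
    | none => none
    | some x =>
      if μ.st.IsCore α ε dcore x then
        if μ.st.streak < L then some (x, dMax α ε dcore μ.st.phase - k) else none
      else
        if μ.cur dcore x ≤ preDepth α ε dcore μ.st.phase then some (x, μ.cur dcore x)
        else some (x, dMax α ε dcore μ.st.phase - k)

/-- A step that does not examine any hash. -/
noncomputable def microSilent {dcore : ℕ} [NeZero n] (α ε : ℝ) (L : ℕ) (μ : Micro n)
    (k : Fin dcore) : Micro n :=
  let st' := μ.st.step α ε dcore L (fun _ _ => 0) k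
  { μ with
    st := st'
    scan := 0
    time := μ.time + 1
    wt := if st'.phase = μ.st.phase then μ.wt
      else weight (preDepth α ε dcore st'.phase) st'.table μ.seen }

/-- What happens when the examined hash turns out to be `v`. -/
noncomputable def microNext {dcore : ℕ} (α ε : ℝ) (μ : Micro n)
    (k : Fin dcore) (v : Fin n) : Micro n :=
  match μ.st.hand with
  | none => μ
  | some x =>
    if μ.st.IsCore α ε dcore x then
      { μ with
        st := { μ.st.placeAt x (dMax α ε dcore μ.st.phase - k) v with streak := μ.st.streak + 1 }
        scan := 0
        time := μ.time + 1
        seen := insert (x, dMax α ε dcore μ.st.phase - k) μ.seen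
        val := Function.update μ.val (x, dMax α ε dcore μ.st.phase - k) v }
    else
      if μ.cur dcore x ≤ preDepth α ε dcore μ.st.phase then
        if μ.st.table v = none then
          { μ with
            st := { μ.st.placeAt x (μ.cur dcore x) v with streak := 0 }
            scan := 0
            time := μ.time + 1
            seen := insert (x, μ.cur dcore x) μ.seen
            val := Function.update μ.val (x, μ.cur dcore x) v }
        else
          { μ with
            scan := μ.cur dcore x + 1
            seen := insert (x, μ.cur dcore x) μ.seen
            val := Function.update μ.val (x, μ.cur dcore x) v }
      else
        { μ with
          st := { μ.st.placeAt x (dMax α ε dcore μ.st.phase - k) v with streak := 0 }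
          scan := 0
          time := μ.time + 1
          seen := insert (x, dMax α ε dcore μ.st.phase - k) μ.seen
          val := Function.update μ.val (x, dMax α ε dcore μ.st.phase - k) v }

/-- The initial state. -/
noncomputable def microInit [NeZero n] (α ε : ℝ) (dcore : ℕ) : Micro n where
  st := State.init n
  scan := 0
  time := 0
  seen := ∅
  val := fun _ => 0
  wt := fun _ => preDepth α ε dcore 1

/-- The state after `T` examinations or silent steps. -/
noncomputable def microRun {dcore : ℕ} [NeZero n] (α ε : ℝ) (L : ℕ) (h : ℕ × ℕ → Fin n)
    (κ : ℕ → Fin dcore) (T : ℕ) : Micro n :=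
  explore (microQuery α ε L) (microSilent α ε L) (microNext α ε) Micro.time h κ T
    (microInit α ε dcore)

section
variable {dcore : ℕ} {α ε : ℝ} {L : ℕ} {μ : Micro n} {k : Fin dcore}

theorem microQuery_eq_none_iff : microQuery α ε L μ k = none ↔
    μ.st.failed = true ∨ μ.st.hand = none ∨
      ∃ x, μ.st.hand = some x ∧ μ.st.IsCore α ε dcore x ∧ ¬ μ.st.streak < L := by
  unfold microQuery
  by_cases hf : μ.st.failed = true
  · simp [hf]
  · cases hh : μ.st.hand with
    | none => simp [hf]
    | some x =>
      by_cases hc : μ.st.IsCore α ε dcore x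
      · by_cases hs : μ.st.streak < L <;> simp [hf, hc, hs]
      · by_cases hs : μ.cur dcore x ≤ preDepth α ε dcore μ.st.phase <;> simp [hf, hc, hs]

/-- The three kinds of examinations: for a core element, for a key that is not a core element, and
for a key that becomes a core element. -/
theorem microQuery_eq_some {p : ℕ × ℕ} (hq : microQuery α ε L μ k = some p) :
    μ.st.failed = false ∧ ∃ x, μ.st.hand = some x ∧ p.1 = x ∧
    ((μ.st.IsCore α ε dcore x ∧ μ.st.streak < L ∧ p.2 = dMax α ε dcore μ.st.phase - k) ∨
     (¬ μ.st.IsCore α ε dcore x ∧ μ.cur dcore x ≤ preDepth α ε dcore μ.st.phase ∧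
        p.2 = μ.cur dcore x) ∨
     (¬ μ.st.IsCore α ε dcore x ∧ ¬ μ.cur dcore x ≤ preDepth α ε dcore μ.st.phase ∧
        p.2 = dMax α ε dcore μ.st.phase - k)) := by
  unfold microQuery at hq
  by_cases hf : μ.st.failed = true
  · simp [hf] at hq
  · refine ⟨by simpa using hf, ?_⟩
    cases hh : μ.st.hand with
    | none => simp [hf, hh] at hq
    | some x =>
      refine ⟨x, rfl, ?_⟩
      simp only [hf, hh] at hq
      by_cases hc : μ.st.IsCore α ε dcore x
      · by_cases hs : μ.st.streak < L
        · simp [hc, hs] at hq; simp [← hq, hc, hs]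
        · simp [hc, hs] at hq
      · by_cases hs : μ.cur dcore x ≤ preDepth α ε dcore μ.st.phase
        · simp [hc, hs] at hq; simp [← hq, hc, hs]
        · simp [hc, hs] at hq; simp [← hq, hc, hs]

/-- The state after the examination of `p`, with the memory updated. -/
def Micro.remember (μ : Micro n) (st : State n) (scan time : ℕ) (p : ℕ × ℕ) (v : Fin n) :
    Micro n :=
  { μ with
    st := st, scan := scan, time := time
    seen := insert p μ.seen, val := Function.update μ.val p v }

/-- In all four outcomes the memory changes in the same way, by recording `p`; only the visible
state, the scan pointer and the clock differ. -/
theorem microNext_cases {p : ℕ × ℕ} (hq : microQuery α ε L μ k = some p) (v : Fin n) :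
    μ.st.failed = false ∧ ∃ x, μ.st.hand = some x ∧
    ((μ.st.IsCore α ε dcore x ∧ μ.st.streak < L ∧ p = (x, dMax α ε dcore μ.st.phase - k) ∧
        microNext α ε μ k v = μ.remember
          { μ.st.placeAt x (dMax α ε dcore μ.st.phase - k) v with streak := μ.st.streak + 1 }
          0 (μ.time + 1) p v) ∨
     (¬ μ.st.IsCore α ε dcore x ∧ μ.cur dcore x ≤ preDepth α ε dcore μ.st.phase ∧
        p = (x, μ.cur dcore x) ∧ μ.st.table v = none ∧
        microNext α ε μ k v = μ.remember
          { μ.st.placeAt x (μ.cur dcore x) v with streak := 0 } 0 (μ.time + 1) p v) ∨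
     (¬ μ.st.IsCore α ε dcore x ∧ μ.cur dcore x ≤ preDepth α ε dcore μ.st.phase ∧
        p = (x, μ.cur dcore x) ∧ μ.st.table v ≠ none ∧
        microNext α ε μ k v = μ.remember μ.st (μ.cur dcore x + 1) μ.time p v) ∨
     (¬ μ.st.IsCore α ε dcore x ∧ ¬ μ.cur dcore x ≤ preDepth α ε dcore μ.st.phase ∧
        p = (x, dMax α ε dcore μ.st.phase - k) ∧
        microNext α ε μ k v = μ.remember
          { μ.st.placeAt x (dMax α ε dcore μ.st.phase - k) v with streak := 0 }
          0 (μ.time + 1) p v)) := by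
  obtain ⟨hf, x, hx, hp1, h⟩ := microQuery_eq_some hq
  refine ⟨hf, x, hx, ?_⟩
  rcases h with ⟨hc, hs, hp2⟩ | ⟨hc, hs, hp2⟩ | ⟨hc, hs, hp2⟩
  · have hp : p = (x, dMax α ε dcore μ.st.phase - k) := Prod.ext hp1 hp2
    exact Or.inl ⟨hc, hs, hp, by simp [microNext, hx, hc, Micro.remember, hp]⟩
  · have hp : p = (x, μ.cur dcore x) := Prod.ext hp1 hp2
    by_cases hv : μ.st.table v = none
    · exact Or.inr (Or.inl ⟨hc, hs, hp, hv, by simp [microNext, hx, hc, hs, hv, Micro.remember, hp]⟩)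
    · exact Or.inr (Or.inr (Or.inl ⟨hc, hs, hp, hv, by
        simp [microNext, hx, hc, hs, hv, Micro.remember, hp]⟩))
  · have hp : p = (x, dMax α ε dcore μ.st.phase - k) := Prod.ext hp1 hp2
    exact Or.inr (Or.inr (Or.inr ⟨hc, hs, hp, by simp [microNext, hx, hc, hs, Micro.remember, hp]⟩))

theorem microNext_seen {p : ℕ × ℕ} (hq : microQuery α ε L μ k = some p) (v : Fin n) :
    (microNext α ε μ k v).seen = insert p μ.seen := by
  obtain ⟨-, x, -, h⟩ := microNext_cases hq v
  rcases h with ⟨-, -, -, h⟩ | ⟨-, -, -, -, h⟩ | ⟨-, -, -, -, h⟩ | ⟨-, -, -, h⟩ <;> rw [h] <;> rfl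

theorem microNext_val {p : ℕ × ℕ} (hq : microQuery α ε L μ k = some p) (v : Fin n) :
    (microNext α ε μ k v).val = Function.update μ.val p v := by
  obtain ⟨-, x, -, h⟩ := microNext_cases hq v
  rcases h with ⟨-, -, -, h⟩ | ⟨-, -, -, -, h⟩ | ⟨-, -, -, -, h⟩ | ⟨-, -, -, h⟩ <;> rw [h] <;> rfl

theorem microNext_wt (v : Fin n) : (microNext α ε μ k v).wt = μ.wt := by
  unfold microNext
  split
  · rfl
  · split_ifs <;> rfl

theorem microNext_phase (v : Fin n) : (microNext α ε μ k v).st.phase = μ.st.phase := by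
  unfold microNext
  split
  · rfl
  · split_ifs <;> rfl

end

/-! ### The refined process simulates the algorithm -/

/-- The slots examined so far in the current step are occupied. -/
def Micro.Scanned (μ : Micro n) (dcore : ℕ) (h : ℕ × ℕ → Fin n) : Prop :=
  ∀ x, μ.st.hand = some x → ∀ i, max 1 (μ.st.choice x - dcore) ≤ i → i < μ.scan →
    μ.st.table (h (x, i)) ≠ none

theorem scanned_of_scan_eq_zero {μ : Micro n} {dcore : ℕ} {h : ℕ × ℕ → Fin n} (hs : μ.scan = 0) :
    μ.Scanned dcore h := by
  intro x _ i _ hi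
  omega

section
variable {dcore : ℕ} [NeZero n] {α ε : ℝ} {L : ℕ} {h : ℕ × ℕ → Fin n} {κ : ℕ → Fin dcore}

/-- A silent step reads no hash, so the constant function in `microSilent` is a harmless dummy. -/
theorem microSilent_st {μ : Micro n} {k : Fin dcore} (hq : microQuery α ε L μ k = none)
    (h' : ℕ → ℕ → Fin n) :
    (microSilent α ε L μ k).st = μ.st.step α ε dcore L h' k := by
  rw [microQuery_eq_none_iff] at hq
  rcases hq with hq | hq | ⟨x, hx, hc, hs⟩
  · simp [microSilent, State.step, hq]
  · simp [microSilent, State.step, hq]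
  · simp [microSilent, State.step, hx, State.move, hc, hs]

/-- A step of `explore` either completes a step of the algorithm or examines an occupied slot. -/
theorem exploreStep_spec (μ : Micro n) (hμ : μ.Scanned dcore h) :
    let μ' := exploreStep (microQuery α ε L) (microSilent α ε L) (microNext α ε) Micro.time h κ μ
    μ'.Scanned dcore h ∧
    ((μ'.time = μ.time + 1 ∧
      μ'.st = μ.st.step α ε dcore L (fun x i => h (x, i)) (κ μ.time)) ∨
     (μ'.time = μ.time ∧ μ'.st = μ.st ∧ μ.scan < μ'.scan ∧
        μ'.scan ≤ preDepth α ε dcore μ.st.phase + 1)) := by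
  intro μ'
  set k := κ μ.time with hk
  cases hq : microQuery α ε L μ k with
  | none =>
    have e : μ' = microSilent α ε L μ k := by
      simp only [μ', exploreStep, ← hk, hq]
    rw [e]
    exact ⟨scanned_of_scan_eq_zero rfl, Or.inl ⟨rfl, microSilent_st hq _⟩⟩
  | some p =>
    have e : μ' = microNext α ε μ k (h p) := by
      simp only [μ', exploreStep, ← hk, hq]
    rw [e]
    obtain ⟨hf, x, hx, hcase⟩ := microNext_cases hq (h p)
    have hmem : ∀ i, i ∈ μ.st.freeIndices α ε dcore (fun x i => h (x, i)) x →
        max 1 (μ.st.choice x - dcore) ≤ i ∧ i ≤ preDepth α ε dcore μ.st.phase ∧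
          μ.cur dcore x ≤ i ∧ μ.st.table (h (x, i)) = none := by
      intro i hi
      simp only [State.freeIndices, Finset.mem_filter, Finset.mem_Icc] at hi
      refine ⟨hi.1.1, hi.1.2, max_le hi.1.1 ?_, hi.2⟩
      by_contra hlt
      exact hμ x hx i hi.1.1 (by omega) hi.2
    rcases hcase with ⟨hc, hs, hp, hN⟩ | ⟨hc, hs, hp, hv, hN⟩ | ⟨hc, hs, hp, hv, hN⟩ |
      ⟨hc, hs, hp, hN⟩
    · rw [hN]
      refine ⟨scanned_of_scan_eq_zero rfl, Or.inl ⟨rfl, ?_⟩⟩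
      simp [Micro.remember, State.step, hf, hx, State.move, hc, hs, State.place, State.placeAt, hp]
    · rw [hN]
      refine ⟨scanned_of_scan_eq_zero rfl, Or.inl ⟨rfl, ?_⟩⟩
      have hin : μ.cur dcore x ∈ μ.st.freeIndices α ε dcore (fun x i => h (x, i)) x := by
        simp only [State.freeIndices, Finset.mem_filter, Finset.mem_Icc]
        exact ⟨⟨le_max_left _ _, hs⟩, by rw [← hp]; exact hv⟩
      -- All admissible indices below `cur` were already found occupied, so `cur` is the first free
      -- one.
      have hmin : (μ.st.freeIndices α ε dcore (fun x i => h (x, i)) x).min' ⟨_, hin⟩ =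
          μ.cur dcore x :=
        le_antisymm (Finset.min'_le _ _ hin) (Finset.le_min' _ _ _ fun i hi => (hmem i hi).2.2.1)
      have hne : (μ.st.freeIndices α ε dcore (fun x i => h (x, i)) x).Nonempty := ⟨_, hin⟩
      simp [Micro.remember, State.step, hf, hx, State.move, hc, hne, hmin, State.place,
        State.placeAt, hp]
    · rw [hN]
      refine ⟨?_, Or.inr ⟨rfl, rfl, Nat.lt_succ_of_le (le_max_right _ _), Nat.succ_le_succ hs⟩⟩
      intro y hy i hi1 hi2
      have hyx : x = y := Option.some.inj (hx.symm.trans hy)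
      subst hyx
      change i < μ.cur dcore x + 1 at hi2
      change max 1 (μ.st.choice x - dcore) ≤ i at hi1
      change μ.st.table (h (x, i)) ≠ none
      by_cases hi3 : i < μ.scan
      · exact hμ x hx i hi1 hi3
      · have : i = μ.cur dcore x := by
          refine le_antisymm (by omega) (max_le hi1 (by omega))
        rw [this, ← hp]; exact hv
    · rw [hN]
      refine ⟨scanned_of_scan_eq_zero rfl, Or.inl ⟨rfl, ?_⟩⟩
      have hne : ¬ (μ.st.freeIndices α ε dcore (fun x i => h (x, i)) x).Nonempty := by
        rintro ⟨i, hi⟩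
        have := hmem i hi
        omega
      simp [Micro.remember, State.step, hf, hx, State.move, hc, hne, State.place, State.placeAt, hp]

theorem microRun_succ (T : ℕ) : microRun α ε L h κ (T + 1) =
    exploreStep (microQuery α ε L) (microSilent α ε L) (microNext α ε) Micro.time h κ
      (microRun α ε L h κ T) :=
  explore_succ' _ _ _ _ _ _ _ _

theorem microRun_scanned (T : ℕ) : (microRun α ε L h κ T).Scanned dcore h := by
  induction T with
  | zero => exact scanned_of_scan_eq_zero rfl
  | succ T ih => rw [microRun_succ]; exact (exploreStep_spec _ ih).1

theorem microRun_st [NeZero dcore] (T : ℕ) : (microRun α ε L h κ T).st =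
    run α ε L (h, κ) (microRun α ε L h κ T).time := by
  induction T with
  | zero => rfl
  | succ T ih =>
    rw [microRun_succ]
    rcases (exploreStep_spec (α := α) (ε := ε) (L := L) (κ := κ) _
      (microRun_scanned (h := h) (κ := κ) T)).2 with ⟨ht, hs⟩ | ⟨ht, hs, -⟩
    · rw [hs, ht, run, ← ih]
    · rw [hs, ht, ih]

/-- The clock cannot stall: an examination that does not complete a step moves the scan pointer up,
and this pointer is bounded by `preDepth + 1`. -/
theorem exists_microRun_time_eq (t : ℕ) : ∃ T, (microRun α ε L h κ T).time = t := by
  induction t with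
  | zero => exact ⟨0, rfl⟩
  | succ t ih =>
    obtain ⟨T, hT⟩ := ih
    by_contra hcon
    push Not at hcon
    have key : ∀ m, (microRun α ε L h κ (T + m)).time = t ∧
        (microRun α ε L h κ (T + m)).st = (microRun α ε L h κ T).st ∧
        (m ≤ (microRun α ε L h κ (T + m)).scan) := by
      intro m
      induction m with
      | zero => exact ⟨hT, rfl, Nat.zero_le _⟩
      | succ m ihm =>
        have h0 := hcon (T + (m + 1))
        rw [← Nat.add_assoc, microRun_succ] at h0 ⊢
        rcases (exploreStep_spec (α := α) (ε := ε) (L := L) (κ := κ) _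
          (microRun_scanned (h := h) (κ := κ) (T + m))).2 with ⟨ht, hs⟩ | ⟨ht, hs, hlt, -⟩
        · exact absurd (by rw [ht, ihm.1]) h0
        · exact ⟨by rw [ht, ihm.1], by rw [hs, ihm.2.1], by omega⟩
    set B := preDepth α ε dcore (microRun α ε L h κ T).st.phase + 1 with hB
    have h1 := key B
    have h0 := hcon (T + B + 1)
    rw [microRun_succ] at h0
    rcases (exploreStep_spec (α := α) (ε := ε) (L := L) (κ := κ) _
      (microRun_scanned (h := h) (κ := κ) (T + B))).2 with ⟨ht, hs⟩ | ⟨ht, hs, hlt, hle⟩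
    · exact absurd (by rw [ht, h1.1]) h0
    · rw [h1.2.1] at hle
      omega

end

/-! ### Phases, weights and the invariants -/

theorem dMax_eq_preDepth_add {α ε : ℝ} {dcore q : ℕ} (hq : 1 ≤ q) :
    dMax α ε dcore q = preDepth α ε dcore q + dcore := by
  unfold preDepth dMax
  have : dcore ≤ q * dcore := Nat.le_mul_of_pos_left _ hq
  omega

/-- The core indices of one phase are ordinary indices in the next, so a new phase starts with no
core pair examined. -/
theorem preDepth_succ {α ε : ℝ} {dcore q : ℕ} :
    preDepth α ε dcore (q + 1) = dMax α ε dcore q := by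
  unfold preDepth dMax
  rw [Nat.succ_mul]
  omega

theorem dMax_le_numHashes {α ε : ℝ} {dcore q : ℕ} (hq : q ≤ lastPhase α ε dcore) :
    dMax α ε dcore q ≤ numHashes α ε := by
  have h3 : q * dcore ≤ lastPhase α ε dcore * dcore := Nat.mul_le_mul_right _ hq
  have h4 := Nat.mod_add_div (numHashes α ε) dcore
  unfold dMax gam
  unfold lastPhase at h3
  rw [mul_comm dcore] at h4
  omega

theorem target_mono {α ε : ℝ} {dcore q : ℕ} :
    target n α ε dcore q ≤ target n α ε dcore (q + 1) := by
  unfold target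
  apply Nat.ceil_mono
  have : (dMax α ε dcore q : ℝ) ≤ dMax α ε dcore (q + 1) := by
    unfold dMax; rw [Nat.succ_mul]; push_cast; linarith [Nat.cast_nonneg (α := ℝ) dcore]
  gcongr

theorem weight_le (J : ℕ) (table : Fin n → Option ℕ) (seen : Finset (ℕ × ℕ)) (s : Fin n) :
    weight J table seen s ≤ J := by
  unfold weight
  split
  · exact le_rfl
  · exact (Finset.card_filter_le _ _).trans (by simp)

theorem weight_mono {J : ℕ} {table table' : Fin n → Option ℕ} {seen seen' : Finset (ℕ × ℕ)}
    {s : Fin n} (ht : table' s = table s) (hs : seen ⊆ seen') :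
    weight J table' seen' s ≤ weight J table seen s := by
  unfold weight
  rw [ht]
  split
  · exact le_rfl
  · exact Finset.card_le_card (Finset.monotone_filter_right _ fun i _ hi h => hi (hs h))

/-- The invariants of the algorithm. -/
structure Micro.Inv (α ε : ℝ) (dcore : ℕ) (μ : Micro n) : Prop where
  phase_pos : 1 ≤ μ.st.phase
  phase_le : μ.st.phase ≤ lastPhase α ε dcore
  count_le : μ.st.count ≤ target n α ε dcore μ.st.phase
  -- Slots are never vacated, so occupancy is a function of the memory alone.
  occ : ∀ s, μ.st.table s ≠ none ↔ ∃ p ∈ μ.seen, μ.val p = s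
  seen_bd : ∀ p ∈ μ.seen, 1 ≤ p.2 ∧ p.2 ≤ dMax α ε dcore μ.st.phase ∧ p.1 < μ.st.count
  table_key : ∀ s x, μ.st.table s = some x →
    (x, μ.st.choice x) ∈ μ.seen ∧ μ.val (x, μ.st.choice x) = s ∧ μ.st.hand ≠ some x
  hand_lt : ∀ x, μ.st.hand = some x → x < μ.st.count
  choice_le : ∀ x, μ.st.choice x ≤ dMax α ε dcore μ.st.phase
  deep : ∀ x i, 1 ≤ i → i < μ.st.choice x - dcore → (x, i) ∈ μ.seen
  core_deep : ∀ x, preDepth α ε dcore μ.st.phase < μ.st.choice x →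
    ∀ i, 1 ≤ i → i ≤ preDepth α ε dcore μ.st.phase → (x, i) ∈ μ.seen
  scan_seen : ∀ x, μ.st.hand = some x → ∀ i, max 1 (μ.st.choice x - dcore) ≤ i → i < μ.scan →
    (x, i) ∈ μ.seen
  -- Within a phase, a slot hit by a core pair can only pass from one core element to another.
  core_slot : ∀ p ∈ μ.seen, preDepth α ε dcore μ.st.phase < p.2 →
    ∃ x, μ.st.table (μ.val p) = some x ∧ preDepth α ε dcore μ.st.phase < μ.st.choice x
  located : ∀ x < μ.st.count, μ.st.hand = some x ∨ ∃ s, μ.st.table s = some x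
  weight_le_wt : ∀ s, (∀ p ∈ μ.seen, preDepth α ε dcore μ.st.phase < p.2 → μ.val p ≠ s) →
    weight (preDepth α ε dcore μ.st.phase) μ.st.table μ.seen s ≤ μ.wt s
  wt_le : ∀ s, μ.wt s ≤ preDepth α ε dcore μ.st.phase

section
variable {dcore : ℕ} {α ε : ℝ} {L : ℕ} {μ : Micro n}

theorem Micro.Inv.isCore_iff (hI : μ.Inv α ε dcore) (x : ℕ) :
    μ.st.IsCore α ε dcore x ↔ preDepth α ε dcore μ.st.phase < μ.st.choice x :=
  ⟨fun h => h.1, fun h => ⟨h, hI.choice_le x⟩⟩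

theorem microInit_inv [NeZero n] [NeZero dcore] (hlast : 1 ≤ lastPhase α ε dcore) :
    (microInit (n := n) α ε dcore).Inv α ε dcore where
  phase_pos := le_rfl
  phase_le := hlast
  count_le := Nat.zero_le _
  occ := by simp [microInit, State.init]
  seen_bd := by simp [microInit]
  table_key := by simp [microInit, State.init]
  hand_lt := by simp [microInit, State.init]
  choice_le := by simp [microInit, State.init]
  deep := by simp [microInit, State.init]
  core_deep := by simp [microInit, State.init]
  scan_seen := by simp [microInit, State.init]
  core_slot := by simp [microInit]
  located := by simp [microInit, State.init]
  weight_le_wt := fun s _ => le_rfl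
  wt_le := fun s => le_rfl

/-- Covers every placement. The two facts that matter are `hfree`, that a non-core index never
evicts, and `hdeep`, that the lower non-core indices have been examined. -/
theorem Micro.Inv.place (hI : μ.Inv α ε dcore) {x i : ℕ} {v : Fin n} (σ t : ℕ)
    (hx : μ.st.hand = some x) (hi1 : 1 ≤ i) (hiD : i ≤ dMax α ε dcore μ.st.phase)
    (hv : (x, i) ∈ μ.seen → v = μ.val (x, i))
    (hfree : i ≤ preDepth α ε dcore μ.st.phase → μ.st.table v = none)
    (hdeep : ∀ i', 1 ≤ i' → i' < i → i' ≤ preDepth α ε dcore μ.st.phase → (x, i') ∈ μ.seen) :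
    (μ.remember { μ.st.placeAt x i v with streak := σ } 0 t (x, i) v).Inv α ε dcore := by
  have hval : ∀ r ∈ μ.seen, Function.update μ.val (x, i) v r = μ.val r := by
    intro r hr
    by_cases h : r = (x, i)
    · subst h; rw [Function.update_self]; exact hv hr
    · rw [Function.update_of_ne h]
  have hDJ := dMax_eq_preDepth_add (α := α) (ε := ε) (dcore := dcore) hI.phase_pos
  constructor
  · exact hI.phase_pos
  · exact hI.phase_le
  · exact hI.count_le
  · intro s
    change Function.update μ.st.table v (some x) s ≠ none ↔
      ∃ p ∈ insert (x, i) μ.seen, Function.update μ.val (x, i) v p = s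
    by_cases hs : s = v
    · subst hs
      simp only [Function.update_self]
      exact ⟨fun _ => ⟨(x, i), Finset.mem_insert_self _ _, Function.update_self _ _ _⟩,
        fun _ => by simp⟩
    · rw [Function.update_of_ne hs, hI.occ s]
      constructor
      · rintro ⟨p, hp, hps⟩
        exact ⟨p, Finset.mem_insert_of_mem hp, by rw [hval p hp, hps]⟩
      · rintro ⟨p, hp, hps⟩
        rcases Finset.mem_insert.1 hp with rfl | hp
        · rw [Function.update_self] at hps; exact absurd hps.symm hs
        · exact ⟨p, hp, by rw [← hval p hp, hps]⟩
  · intro p hp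
    rcases Finset.mem_insert.1 hp with rfl | hp
    · exact ⟨hi1, hiD, hI.hand_lt x hx⟩
    · exact hI.seen_bd p hp
  · intro s z hz
    change Function.update μ.st.table v (some x) s = some z at hz
    change (z, Function.update μ.st.choice x i z) ∈ insert (x, i) μ.seen ∧
      Function.update μ.val (x, i) v (z, Function.update μ.st.choice x i z) = s ∧
      μ.st.table v ≠ some z
    by_cases hs : s = v
    · subst hs
      rw [Function.update_self] at hz
      obtain rfl := Option.some.inj hz
      rw [Function.update_self]
      exact ⟨Finset.mem_insert_self _ _, Function.update_self _ _ _,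
        fun h => (hI.table_key s x h).2.2 hx⟩
    · rw [Function.update_of_ne hs] at hz
      obtain ⟨h1, h2, h3⟩ := hI.table_key s z hz
      have hzx : z ≠ x := fun h => h3 (h ▸ hx)
      rw [Function.update_of_ne hzx, hval _ h1]
      exact ⟨Finset.mem_insert_of_mem h1, h2,
        fun h => hs (h2.symm.trans (hI.table_key v z h).2.1)⟩
  · intro z hz
    change μ.st.table v = some z at hz
    exact (hI.seen_bd _ (hI.table_key v z hz).1).2.2
  · intro z
    change Function.update μ.st.choice x i z ≤ _
    by_cases hzx : z = x
    · subst hzx; rw [Function.update_self]; exact hiD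
    · rw [Function.update_of_ne hzx]; exact hI.choice_le z
  · intro z i' h1 h2
    change i' < Function.update μ.st.choice x i z - dcore at h2
    refine Finset.mem_insert_of_mem ?_
    by_cases hzx : z = x
    · subst hzx; rw [Function.update_self] at h2
      exact hdeep i' h1 (by omega) (by omega)
    · rw [Function.update_of_ne hzx] at h2; exact hI.deep z i' h1 h2
  · intro z hz i' h1 h2
    change preDepth α ε dcore μ.st.phase < Function.update μ.st.choice x i z at hz
    change i' ≤ preDepth α ε dcore μ.st.phase at h2
    refine Finset.mem_insert_of_mem ?_
    by_cases hzx : z = x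
    · subst hzx; rw [Function.update_self] at hz
      exact hdeep i' h1 (by omega) h2
    · rw [Function.update_of_ne hzx] at hz; exact hI.core_deep z hz i' h1 h2
  · intro z _ i' _ h2
    exact absurd h2 (Nat.not_lt_zero _)
  · intro r hr hJ
    change preDepth α ε dcore μ.st.phase < r.2 at hJ
    change ∃ z, Function.update μ.st.table v (some x) (Function.update μ.val (x, i) v r) = some z ∧
      preDepth α ε dcore μ.st.phase < Function.update μ.st.choice x i z
    rcases Finset.mem_insert.1 hr with rfl | hr
    · exact ⟨x, by rw [Function.update_self, Function.update_self],
        by rw [Function.update_self]; exact hJ⟩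
    · rw [hval r hr]
      obtain ⟨z, hz1, hz2⟩ := hI.core_slot r hr hJ
      by_cases hrv : μ.val r = v
      · refine ⟨x, by rw [hrv, Function.update_self], ?_⟩
        rw [Function.update_self]
        -- A placement at a non-core index needs a free slot, but this slot holds a core element.
        by_contra hle
        have := hfree (by omega)
        rw [hrv, this] at hz1
        cases hz1
      · have hzx : z ≠ x := fun h => (hI.table_key _ z hz1).2.2 (h ▸ hx)
        exact ⟨z, by rw [Function.update_of_ne hrv]; exact hz1,
          by rw [Function.update_of_ne hzx]; exact hz2⟩
  · intro z hz
    change z < μ.st.count at hz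
    change μ.st.table v = some z ∨ ∃ s, Function.update μ.st.table v (some x) s = some z
    by_cases hzx : z = x
    · subst hzx; exact Or.inr ⟨v, Function.update_self _ _ _⟩
    · rcases hI.located z hz with h | ⟨s, hs⟩
      · rw [hx] at h; exact absurd (Option.some.inj h).symm hzx
      · by_cases hsv : s = v
        · subst hsv; exact Or.inl hs
        · exact Or.inr ⟨s, by rw [Function.update_of_ne hsv]; exact hs⟩
  · intro s hs
    change ∀ p ∈ insert (x, i) μ.seen, preDepth α ε dcore μ.st.phase < p.2 →
      Function.update μ.val (x, i) v p ≠ s at hs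
    change weight (preDepth α ε dcore μ.st.phase) (Function.update μ.st.table v (some x))
      (insert (x, i) μ.seen) s ≤ μ.wt s
    have hs' : ∀ p ∈ μ.seen, preDepth α ε dcore μ.st.phase < p.2 → μ.val p ≠ s := by
      intro p hp hJ
      rw [← hval p hp]
      exact hs p (Finset.mem_insert_of_mem hp) hJ
    by_cases hsv : s = v
    · subst hsv
      -- The slot is not hit in the core, so it was free before and already had the maximal weight.
      have hiJ : i ≤ preDepth α ε dcore μ.st.phase := by
        by_contra hlt
        exact hs (x, i) (Finset.mem_insert_self _ _) (by simpa using hlt)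
          (Function.update_self _ _ _)
      refine (weight_le _ _ _ _).trans ?_
      have := hI.weight_le_wt s hs'
      unfold weight at this
      rw [hfree hiJ] at this
      exact this
    · exact (weight_mono (Function.update_of_ne hsv _ _) (Finset.subset_insert _ _)).trans
        (hI.weight_le_wt s hs')
  · exact hI.wt_le

theorem Micro.Inv.scan (hI : μ.Inv α ε dcore) {x : ℕ} {v : Fin n} (t : ℕ)
    (hx : μ.st.hand = some x) (hcur : μ.cur dcore x ≤ preDepth α ε dcore μ.st.phase)
    (hv : (x, μ.cur dcore x) ∈ μ.seen → v = μ.val (x, μ.cur dcore x))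
    (hocc : μ.st.table v ≠ none) :
    (μ.remember μ.st (μ.cur dcore x + 1) t (x, μ.cur dcore x) v).Inv α ε dcore := by
  set i := μ.cur dcore x with hi
  have hval : ∀ r ∈ μ.seen, Function.update μ.val (x, i) v r = μ.val r := by
    intro r hr
    by_cases h : r = (x, i)
    · subst h; rw [Function.update_self]; exact hv hr
    · rw [Function.update_of_ne h]
  have hDJ := dMax_eq_preDepth_add (α := α) (ε := ε) (dcore := dcore) hI.phase_pos
  have hi1 : 1 ≤ i := (le_max_left _ _).trans (le_max_left _ _)
  constructor
  · exact hI.phase_pos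
  · exact hI.phase_le
  · exact hI.count_le
  · intro s
    change μ.st.table s ≠ none ↔
      ∃ p ∈ insert (x, i) μ.seen, Function.update μ.val (x, i) v p = s
    constructor
    · intro h
      obtain ⟨p, hp, hps⟩ := (hI.occ s).1 h
      exact ⟨p, Finset.mem_insert_of_mem hp, by rw [hval p hp, hps]⟩
    · rintro ⟨p, hp, hps⟩
      rcases Finset.mem_insert.1 hp with rfl | hp
      · rw [Function.update_self] at hps; rw [← hps]; exact hocc
      · exact (hI.occ s).2 ⟨p, hp, by rw [← hval p hp, hps]⟩
  · intro p hp
    rcases Finset.mem_insert.1 hp with rfl | hp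
    · refine ⟨hi1, ?_, hI.hand_lt x hx⟩
      change i ≤ dMax α ε dcore μ.st.phase
      omega
    · exact hI.seen_bd p hp
  · intro s z hz
    obtain ⟨h1, h2, h3⟩ := hI.table_key s z hz
    exact ⟨Finset.mem_insert_of_mem h1, (hval _ h1).trans h2, h3⟩
  · exact hI.hand_lt
  · exact hI.choice_le
  · exact fun z i' h1 h2 => Finset.mem_insert_of_mem (hI.deep z i' h1 h2)
  · exact fun z hz i' h1 h2 => Finset.mem_insert_of_mem (hI.core_deep z hz i' h1 h2)
  · intro z hz i' h1 h2
    obtain rfl : x = z := Option.some.inj (hx.symm.trans hz)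
    change i' < i + 1 at h2
    change max 1 (μ.st.choice x - dcore) ≤ i' at h1
    change (x, i') ∈ insert (x, i) μ.seen
    by_cases hii : i' = i
    · rw [hii]; exact Finset.mem_insert_self _ _
    · refine Finset.mem_insert_of_mem (hI.scan_seen x hx i' h1 ?_)
      by_contra hle
      exact hii (le_antisymm (by omega) (max_le h1 (by omega)))
  · intro r hr hJ
    change preDepth α ε dcore μ.st.phase < r.2 at hJ
    rcases Finset.mem_insert.1 hr with rfl | hr
    · exact absurd hJ (by simpa using hcur)
    · change ∃ z, μ.st.table (Function.update μ.val (x, i) v r) = some z ∧ _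
      rw [hval r hr]
      exact hI.core_slot r hr hJ
  · exact hI.located
  · intro s hs
    refine (weight_mono rfl (Finset.subset_insert _ _)).trans (hI.weight_le_wt s fun p hp hJ => ?_)
    rw [← hval p hp]
    exact hs p (Finset.mem_insert_of_mem hp) hJ
  · exact hI.wt_le

/-- Indices below `cur` have been examined: those below `choice x - dcore` in the past, by `deep`,
and the rest during the current scan. -/
theorem Micro.Inv.next {k : Fin dcore} (hI : μ.Inv α ε dcore) {p : ℕ × ℕ} {v : Fin n}
    (hq : microQuery α ε L μ k = some p) (hv : p ∈ μ.seen → v = μ.val p) :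
    (microNext α ε μ k v).Inv α ε dcore := by
  have hDJ := dMax_eq_preDepth_add (α := α) (ε := ε) (dcore := dcore) hI.phase_pos
  have hk := k.isLt
  obtain ⟨-, x, hx, h⟩ := microNext_cases hq v
  have hlow : ∀ i, 1 ≤ i → i < μ.cur dcore x → (x, i) ∈ μ.seen := by
    intro i h1 h2
    by_cases h3 : i < μ.st.choice x - dcore
    · exact hI.deep x i h1 h3
    · refine hI.scan_seen x hx i (max_le h1 (by omega)) ?_
      unfold Micro.cur at h2
      rcases lt_max_iff.1 h2 with h2 | h2
      · exact absurd h2 (not_lt.2 (max_le h1 (by omega)))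
      · exact h2
  rcases h with ⟨hc, -, rfl, h⟩ | ⟨hc, hle, rfl, hfree, h⟩ | ⟨hc, hle, rfl, hocc, h⟩ |
    ⟨hc, hle, rfl, h⟩ <;> rw [h]
  · exact hI.place _ _ hx (by omega) (by omega) hv (fun h => by omega)
      fun i h1 _ h3 => hI.core_deep x ((hI.isCore_iff x).1 hc) i h1 h3
  · exact hI.place _ _ hx ((le_max_left _ _).trans (le_max_left _ _)) (by omega) hv
      (fun _ => hfree) fun i h1 h2 _ => hlow i h1 h2
  · exact hI.scan _ hx hle hv hocc
  · exact hI.place _ _ hx (by omega) (by omega) hv (fun h => by omega)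
      fun i h1 _ h3 => hlow i h1 (by omega)

/-- The silent steps: nothing happens to the table, a new phase begins after all keys have been
placed, or a new key is taken. -/
theorem microSilent_cases [NeZero n] {k : Fin dcore} (hq : microQuery α ε L μ k = none) :
    (microSilent α ε L μ k).seen = μ.seen ∧ (microSilent α ε L μ k).val = μ.val ∧
    (microSilent α ε L μ k).scan = 0 ∧
    (((microSilent α ε L μ k).wt = μ.wt ∧
      ∃ b, (microSilent α ε L μ k).st = { μ.st with failed := b }) ∨
     (μ.st.PhaseComplete α ε dcore ∧ μ.st.phase < lastPhase α ε dcore ∧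
        (microSilent α ε L μ k).st = { μ.st with phase := μ.st.phase + 1 } ∧
        (microSilent α ε L μ k).wt =
          weight (preDepth α ε dcore (μ.st.phase + 1)) μ.st.table μ.seen) ∨
     (μ.st.hand = none ∧ ¬ μ.st.PhaseComplete α ε dcore ∧ (microSilent α ε L μ k).wt = μ.wt ∧
        (microSilent α ε L μ k).st =
          { μ.st with hand := some μ.st.count, count := μ.st.count + 1, streak := 0 })) := by
  refine ⟨rfl, rfl, rfl, ?_⟩
  by_cases hf : μ.st.failed = true
  · left
    have h : (microSilent α ε L μ k).st = μ.st := by simp [microSilent, State.step, hf]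
    exact ⟨by simp [microSilent, State.step, hf], true, by rw [h, ← hf]⟩
  rcases microQuery_eq_none_iff.1 hq with hq | hq | ⟨x, hx, hc, hs⟩
  · exact absurd hq hf
  · by_cases hcomp : μ.st.PhaseComplete α ε dcore
    · by_cases hlt : μ.st.phase < lastPhase α ε dcore
      · right; left
        exact ⟨hcomp, hlt, by simp [microSilent, State.step, hf, hq, hcomp, hlt],
          by simp [microSilent, State.step, hf, hq, hcomp, hlt]⟩
      · left
        have h : (microSilent α ε L μ k).st = μ.st := by
          simp [microSilent, State.step, hf, hq, hcomp, hlt]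
        exact ⟨by simp [microSilent, State.step, hf, hq, hcomp, hlt], μ.st.failed, by rw [h]⟩
    · right; right
      exact ⟨hq, hcomp, by simp [microSilent, State.step, hf, hq, hcomp],
        by simp [microSilent, State.step, hf, hq, hcomp]⟩
  · left
    exact ⟨by simp [microSilent, State.step, hf, hx, State.move, hc, hs], true,
      by simp [microSilent, State.step, hf, hx, State.move, hc, hs]⟩

theorem Micro.Inv.silent [NeZero n] {k : Fin dcore} (hI : μ.Inv α ε dcore)
    (hq : microQuery α ε L μ k = none) : (microSilent α ε L μ k).Inv α ε dcore := by
  obtain ⟨h1, h2, h3, h⟩ := microSilent_cases hq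
  have hDJ := dMax_eq_preDepth_add (α := α) (ε := ε) (dcore := dcore) hI.phase_pos
  generalize microSilent α ε L μ k = μ' at *
  obtain ⟨st', scan', time', seen', val', wt'⟩ := μ'
  dsimp only at h1 h2 h3 h
  subst h1 h2 h3
  rcases h with ⟨rfl, b, rfl⟩ | ⟨hcomp, hlt, rfl, rfl⟩ | ⟨hh, hcomp, rfl, rfl⟩
  · exact
    { phase_pos := hI.phase_pos
      phase_le := hI.phase_le
      count_le := hI.count_le
      occ := hI.occ
      seen_bd := hI.seen_bd
      table_key := hI.table_key
      hand_lt := hI.hand_lt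
      choice_le := hI.choice_le
      deep := hI.deep
      core_deep := hI.core_deep
      scan_seen := fun x _ i _ h => absurd h (Nat.not_lt_zero _)
      core_slot := hI.core_slot
      located := hI.located
      weight_le_wt := hI.weight_le_wt
      wt_le := hI.wt_le }
  · have hD' := dMax_eq_preDepth_add (α := α) (ε := ε) (dcore := dcore) (q := μ.st.phase + 1)
      (by omega)
    have hJ' := preDepth_succ (α := α) (ε := ε) (dcore := dcore) (q := μ.st.phase)
    -- All examined indices are at most the old d_max, which is the new depth; the core conditions
    -- are therefore vacuous.
    have hno : ∀ p ∈ μ.seen, ¬ preDepth α ε dcore (μ.st.phase + 1) < p.2 := by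
      intro p hp
      have := (hI.seen_bd p hp).2.1
      omega
    exact
    { phase_pos := Nat.le_add_left _ _
      phase_le := hlt
      count_le := hI.count_le.trans target_mono
      occ := hI.occ
      seen_bd := fun p hp => ⟨(hI.seen_bd p hp).1,
        (hI.seen_bd p hp).2.1.trans (by dsimp only; omega), (hI.seen_bd p hp).2.2⟩
      table_key := hI.table_key
      hand_lt := hI.hand_lt
      choice_le := fun x => (hI.choice_le x).trans (by dsimp only; omega)
      deep := hI.deep
      core_deep := fun x h => absurd h (by
        have := hI.choice_le x
        dsimp only; omega)
      scan_seen := fun x _ i _ h => absurd h (Nat.not_lt_zero _)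
      core_slot := fun p hp h => absurd h (hno p hp)
      located := hI.located
      weight_le_wt := fun s _ => le_rfl
      wt_le := fun s => weight_le _ _ _ _ }
  · have hcnt : μ.st.count < target n α ε dcore μ.st.phase := by
      by_contra hle
      exact hcomp ⟨hh, by omega⟩
    exact
    { phase_pos := hI.phase_pos
      phase_le := hI.phase_le
      count_le := hcnt
      occ := hI.occ
      seen_bd := fun p hp => ⟨(hI.seen_bd p hp).1, (hI.seen_bd p hp).2.1,
        (hI.seen_bd p hp).2.2.trans (Nat.lt_succ_self _)⟩
      table_key := fun s x h => ⟨(hI.table_key s x h).1, (hI.table_key s x h).2.1, fun h' => by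
        have := (hI.seen_bd _ (hI.table_key s x h).1).2.2
        have h'' := Option.some.inj h'
        dsimp only at this
        omega⟩
      hand_lt := fun x h => by
        have h'' := Option.some.inj h
        dsimp only
        omega
      choice_le := hI.choice_le
      deep := hI.deep
      core_deep := hI.core_deep
      scan_seen := fun x _ i _ h => absurd h (Nat.not_lt_zero _)
      core_slot := hI.core_slot
      located := fun x hx => by
        dsimp only at hx ⊢
        rcases Nat.lt_succ_iff_lt_or_eq.1 hx with hx | rfl
        · rcases hI.located x hx with h | h
          · rw [hh] at h; cases h
          · exact Or.inr h
        · exact Or.inl rfl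
      weight_le_wt := hI.weight_le_wt
      wt_le := hI.wt_le }

theorem microRun_inv [NeZero n] [NeZero dcore] {h : ℕ × ℕ → Fin n} {κ : ℕ → Fin dcore}
    (hlast : 1 ≤ lastPhase α ε dcore) (T : ℕ) :
    (microRun α ε L h κ T).Inv α ε dcore ∧
      ∀ p ∈ (microRun α ε L h κ T).seen, (microRun α ε L h κ T).val p = h p := by
  induction T with
  | zero => exact ⟨microInit_inv hlast, by simp [microRun, explore, microInit]⟩
  | succ T ih =>
    rw [microRun_succ]
    generalize microRun α ε L h κ T = μ at ih
    unfold exploreStep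
    cases hq : microQuery α ε L μ (κ μ.time) with
    | none =>
      refine ⟨ih.1.silent hq, ?_⟩
      obtain ⟨h1, h2, -⟩ := microSilent_cases hq
      dsimp only
      rw [h1, h2]; exact ih.2
    | some p =>
      refine ⟨ih.1.next hq fun hp => (ih.2 p hp).symm, ?_⟩
      dsimp only
      rw [microNext_seen hq, microNext_val hq]
      intro r hr
      by_cases hrp : r = p
      · rw [hrp, Function.update_self]
      · rw [Function.update_of_ne hrp]
        exact ih.2 r ((Finset.mem_insert.1 hr).resolve_left hrp)

end

/-! ### Counting slots, weights and core elements -/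

/-- The examined pairs beyond depth `J`. -/
def Micro.corePairs (μ : Micro n) (J : ℕ) : Finset (ℕ × ℕ) := μ.seen.filter fun p => J < p.2

/-- The slots which have not been examined. -/
def Micro.free (μ : Micro n) : Finset (Fin n) := (μ.seen.image μ.val)ᶜ

/-- The slots which have not been examined beyond depth `J`. -/
def Micro.unhit (μ : Micro n) (J : ℕ) : Finset (Fin n) := ((μ.corePairs J).image μ.val)ᶜ

section counting
variable {dcore : ℕ} {α ε : ℝ} {μ : Micro n}

theorem weight_add_card {J : ℕ} {table : Fin n → Option ℕ} {seen : Finset (ℕ × ℕ)}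
    (h1 : ∀ p ∈ seen, 1 ≤ p.2) (s : Fin n) :
    weight J table seen s +
      ((seen.filter fun p => p.2 ≤ J).filter fun p => table s = some p.1).card = J := by
  unfold weight
  cases hs : table s with
  | none => simp
  | some x =>
    have : ((seen.filter fun p => p.2 ≤ J).filter fun p => some x = some p.1) =
        ((Finset.Icc 1 J).filter fun i => ¬ (x, i) ∉ seen).image (fun i => (x, i)) := by
      ext ⟨y, i⟩
      simp only [Finset.mem_filter, Finset.mem_image, Finset.mem_Icc, Option.some.injEq,
        Prod.mk.injEq, not_not]
      constructor
      · rintro ⟨⟨h, hi⟩, rfl⟩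
        exact ⟨i, ⟨⟨h1 _ h, hi⟩, h⟩, rfl, rfl⟩
      · rintro ⟨i', ⟨⟨-, hi⟩, h⟩, rfl, rfl⟩
        exact ⟨⟨h, hi⟩, rfl⟩
    dsimp only
    rw [this, Finset.card_image_of_injective _ (fun a b h => (Prod.mk.inj h).2),
      Finset.card_filter_add_card_filter_not]
    simp

/-- Double counting of pairs of a slot and an examined hash of its occupant. -/
theorem sum_weight_add {J : ℕ} {table : Fin n → Option ℕ} {seen : Finset (ℕ × ℕ)}
    (h1 : ∀ p ∈ seen, 1 ≤ p.2) :
    ∑ s, weight J table seen s + ∑ p ∈ seen.filter (fun p => p.2 ≤ J),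
      (Finset.univ.filter fun s => table s = some p.1).card = J * n := by
  have h := Finset.sum_card_bipartiteAbove_eq_sum_card_bipartiteBelow
    (s := (Finset.univ : Finset (Fin n))) (t := seen.filter fun p => p.2 ≤ J)
    (fun s p => table s = some p.1)
  unfold Finset.bipartiteAbove Finset.bipartiteBelow at h
  rw [← h, ← Finset.sum_add_distrib]
  simp only [weight_add_card h1]
  simp [mul_comm]

theorem Micro.Inv.card_slots_le (hI : μ.Inv α ε dcore) (x : ℕ) :
    (Finset.univ.filter fun s => μ.st.table s = some x).card ≤ 1 := by
  rw [Finset.card_le_one]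
  intro s hs t ht
  simp only [Finset.mem_filter, Finset.mem_univ, true_and] at hs ht
  rw [← (hI.table_key s x hs).2.1, (hI.table_key t x ht).2.1]

/-- In `sum_weight_add` every examined pair is counted at most once, as a key occupies at most one
slot. -/
theorem Micro.Inv.mul_le_sum_weight (hI : μ.Inv α ε dcore) (J : ℕ) :
    J * n ≤ ∑ s, weight J μ.st.table μ.seen s + (μ.seen.filter fun p => p.2 ≤ J).card := by
  rw [← sum_weight_add (table := μ.st.table) fun p hp => (hI.seen_bd p hp).1, Finset.card_eq_sum_ones]
  gcongr with p hp
  exact hI.card_slots_le p.1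

/-- With no key in hand, every key with an examined hash occupies a slot, so each pair is counted at
least once. -/
theorem Micro.Inv.sum_weight_le (hI : μ.Inv α ε dcore) (hh : μ.st.hand = none) (J : ℕ) :
    ∑ s, weight J μ.st.table μ.seen s + (μ.seen.filter fun p => p.2 ≤ J).card ≤ J * n := by
  rw [← sum_weight_add (table := μ.st.table) fun p hp => (hI.seen_bd p hp).1, Finset.card_eq_sum_ones]
  gcongr with p hp
  rcases hI.located p.1 (hI.seen_bd p (Finset.mem_filter.1 hp).1).2.2 with h | ⟨s, hs⟩
  · rw [hh] at h; cases h
  · exact Finset.card_pos.2 ⟨s, by simpa using hs⟩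

/-- The number of pairs examined beyond the depth `J` is controlled by the weight of the slots
which have not been hit beyond this depth. -/
theorem Micro.Inv.mul_add_card_le (hI : μ.Inv α ε dcore) :
    preDepth α ε dcore μ.st.phase * n + (μ.corePairs (preDepth α ε dcore μ.st.phase)).card ≤
      ∑ s ∈ μ.unhit (preDepth α ε dcore μ.st.phase), μ.wt s + μ.seen.card := by
  set J := preDepth α ε dcore μ.st.phase with hJ
  have h1 := hI.mul_le_sum_weight J
  have h2 : ∑ s, weight J μ.st.table μ.seen s ≤ ∑ s ∈ μ.unhit J, μ.wt s := by
    rw [← Finset.sum_subset (Finset.subset_univ (μ.unhit J))]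
    · refine Finset.sum_le_sum fun s hs => hI.weight_le_wt s fun p hp hJp hps => ?_
      simp only [Micro.unhit, Micro.corePairs, Finset.mem_compl, Finset.mem_image,
        Finset.mem_filter] at hs
      exact hs ⟨p, ⟨hp, hJp⟩, hps⟩
    -- A slot hit beyond depth J holds a core element, whose first J hashes have all been examined;
    -- its weight is 0.
    · intro s _ hs
      simp only [Micro.unhit, Micro.corePairs, Finset.mem_compl, Finset.mem_image,
        Finset.mem_filter, not_not] at hs
      obtain ⟨p, ⟨hp, hJp⟩, rfl⟩ := hs
      obtain ⟨x, hx, hxJ⟩ := hI.core_slot p hp hJp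
      unfold weight
      rw [hx]
      refine Finset.card_eq_zero.2 (Finset.filter_eq_empty_iff.2 fun i hi => ?_)
      rw [Finset.mem_Icc] at hi
      exact not_not.2 (hI.core_deep x hxJ i hi.1 hi.2)
  have h3 : (μ.seen.filter fun p => p.2 ≤ J).card + (μ.corePairs J).card = μ.seen.card := by
    have := Finset.card_filter_add_card_filter_not (s := μ.seen) (fun p => p.2 ≤ J)
    simpa only [not_le, Micro.corePairs] using this
  omega

/-- Examined slots are occupied, and by distinct keys. -/
theorem Micro.Inv.le_free_add_count (hI : μ.Inv α ε dcore) :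
    n ≤ μ.free.card + μ.st.count := by
  have h1 : (μ.seen.image μ.val).card ≤ μ.st.count := by
    have : ∀ s ∈ μ.seen.image μ.val, ∃ x, μ.st.table s = some x := by
      intro s hs
      obtain ⟨p, hp, hps⟩ := Finset.mem_image.1 hs
      exact Option.ne_none_iff_exists'.1 ((hI.occ s).2 ⟨p, hp, hps⟩)
    choose! f hf using this
    rw [← Finset.card_range μ.st.count]
    refine Finset.card_le_card_of_injOn f (fun s hs => ?_) fun s hs t ht hst => ?_
    · simpa using (hI.seen_bd _ (hI.table_key s _ (hf s hs)).1).2.2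
    · rw [← (hI.table_key s _ (hf s hs)).2.1, ← (hI.table_key t _ (hf t ht)).2.1, hst]
  have h2 := Finset.card_compl_add_card (μ.seen.image μ.val)
  rw [Fintype.card_fin] at h2
  unfold Micro.free
  omega

theorem Micro.Inv.free_add_count_le (hI : μ.Inv α ε dcore) (hh : μ.st.hand = none) :
    μ.free.card + μ.st.count ≤ n := by
  have h1 : μ.st.count ≤ (μ.seen.image μ.val).card := by
    have : ∀ x < μ.st.count, ∃ s, μ.st.table s = some x := fun x hx => by
      rcases hI.located x hx with h | h
      · rw [hh] at h; cases h
      · exact h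
    rw [← Finset.card_range μ.st.count]
    refine Finset.card_le_card_of_injOn (fun x => μ.val (x, μ.st.choice x)) (fun x hx => ?_)
      fun x hx y hy hxy => ?_
    · obtain ⟨s, hs⟩ := this x (by simpa using hx)
      exact Finset.mem_coe.2 (Finset.mem_image_of_mem _ (hI.table_key s x hs).1)
    · obtain ⟨s, hs⟩ := this x (by simpa using hx)
      obtain ⟨t, ht⟩ := this y (by simpa using hy)
      dsimp only at hxy
      rw [(hI.table_key s x hs).2.1, (hI.table_key t y ht).2.1] at hxy
      rw [hxy, ht] at hs
      exact (Option.some.inj hs).symm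
  have h2 := Finset.card_compl_add_card (μ.seen.image μ.val)
  rw [Fintype.card_fin] at h2
  unfold Micro.free
  omega

/-- Core elements in the table inject into the slots hit in the core, each through the hash it is
using. The extra 1 is for a core element in hand. -/
theorem Micro.Inv.coreCount_add_unhit_le (hI : μ.Inv α ε dcore) :
    μ.st.coreCount α ε dcore + (μ.unhit (preDepth α ε dcore μ.st.phase)).card ≤ n + 1 := by
  set J := preDepth α ε dcore μ.st.phase with hJ
  set C := (Finset.range μ.st.count).filter (fun x => μ.st.IsCore α ε dcore x) with hC
  have h1 : (C.filter fun x => μ.st.hand ≠ some x).card ≤ ((μ.corePairs J).image μ.val).card := by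
    have hloc : ∀ x ∈ C.filter (fun x => μ.st.hand ≠ some x), ∃ s, μ.st.table s = some x := by
      intro x hx
      rw [Finset.mem_filter, hC, Finset.mem_filter, Finset.mem_range] at hx
      exact (hI.located x hx.1.1).resolve_left hx.2
    refine Finset.card_le_card_of_injOn (fun x => μ.val (x, μ.st.choice x)) (fun x hx => ?_)
      fun x hx y hy hxy => ?_
    · obtain ⟨s, hs⟩ := hloc x hx
      refine Finset.mem_coe.2 (Finset.mem_image_of_mem _ ?_)
      rw [Finset.mem_coe, Finset.mem_filter, hC, Finset.mem_filter] at hx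
      exact Finset.mem_filter.2 ⟨(hI.table_key s x hs).1, (hI.isCore_iff x).1 hx.1.2⟩
    · obtain ⟨s, hs⟩ := hloc x hx
      obtain ⟨t, ht⟩ := hloc y hy
      dsimp only at hxy
      rw [(hI.table_key s x hs).2.1, (hI.table_key t y ht).2.1] at hxy
      rw [hxy, ht] at hs
      exact (Option.some.inj hs).symm
  have h2 : (C.filter fun x => ¬ μ.st.hand ≠ some x).card ≤ 1 := by
    rw [Finset.card_le_one]
    intro x hx y hy
    have hx' := (Finset.mem_filter.1 hx).2
    have hy' := (Finset.mem_filter.1 hy).2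
    rw [not_not] at hx' hy'
    exact Option.some.inj (hx'.symm.trans hy')
  have h3 := Finset.card_filter_add_card_filter_not (s := C) (fun x => μ.st.hand ≠ some x)
  have h4 := Finset.card_compl_add_card ((μ.corePairs J).image μ.val)
  rw [Fintype.card_fin] at h4
  change C.card + _ ≤ _
  unfold Micro.unhit
  omega

end counting

/-! ### Unlikely events and the total potential -/

/-- The parameters of the large deviation bounds: `lenHi q` and `freeHi q` for the event that too
many slots are free after many examinations, `freeLo q` for the event that too few slots are free
at the beginning of phase `q`, `unhitLo` and `weightHi` for the events that too few slots have not
been hit, or carry too much weight, after `coreLen` examinations in the core. -/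
structure Thresholds where
  η : ℝ
  lam : ℝ
  freeHi : ℕ → ℝ
  freeLo : ℕ → ℝ
  lenHi : ℕ → ℕ
  coreLen : ℕ
  unhitLo : ℝ
  weightHi : ℝ

namespace Thresholds

/-- The factor by which weights decay in one examination, with a margin from above. -/
noncomputable def rho (θ : Thresholds) (n : ℕ) : ℝ := 1 - (1 - θ.η) / n

/-- The factor by which weights decay in one examination, with a margin from below. -/
noncomputable def sig (θ : Thresholds) (n : ℕ) : ℝ := 1 - (1 + θ.η) / n

variable (θ : Thresholds) (α ε : ℝ) (dcore q : ℕ) (μ : Micro n)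

/-- Too many slots are free after many examinations. -/
def BadHi : Prop := θ.lenHi q ≤ μ.seen.card ∧ θ.freeHi q ≤ μ.free.card

/-- Too few slots are free after few examinations. -/
def BadLo : Prop :=
  μ.seen.card ≤ (preDepth α ε dcore q - dcore) * n ∧ (μ.free.card : ℝ) ≤ θ.freeLo q

/-- Too few slots have not been hit in the core. -/
def BadUnhit : Prop :=
  μ.st.phase = q ∧ (μ.corePairs (preDepth α ε dcore q)).card ≤ θ.coreLen ∧
    ((μ.unhit (preDepth α ε dcore q)).card : ℝ) ≤ θ.unhitLo

/-- The slots which have not been hit in the core have too much weight. -/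
def BadWeight : Prop :=
  μ.st.phase = q ∧ θ.coreLen ≤ (μ.corePairs (preDepth α ε dcore q)).card ∧
    θ.weightHi ≤ ∑ s ∈ μ.unhit (preDepth α ε dcore q), (μ.wt s : ℝ)

/-- One of the four unlikely events occurs. -/
def Bad : Prop :=
  ∃ q ∈ Finset.Icc 1 (lastPhase α ε dcore), θ.BadHi q μ ∨ θ.BadLo α ε dcore q μ ∨
    θ.BadUnhit α ε dcore q μ ∨ θ.BadWeight α ε dcore q μ

/-- The potential for `BadHi`. -/
noncomputable def potHi : ℝ :=
  upPot θ.η (θ.rho n) (θ.freeHi q) (θ.lenHi q) μ.seen.card μ.free.card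

/-- The potential for `BadLo`. -/
noncomputable def potLo : ℝ :=
  loPot θ.η (θ.sig n) (θ.freeLo q) ((preDepth α ε dcore q - dcore) * n) μ.seen.card μ.free.card

/-- The potential for `BadUnhit`. -/
noncomputable def potUnhit : ℝ :=
  -- A phase not yet begun is charged its starting value; a finished phase is charged nothing.
  if μ.st.phase < q then loPot θ.η (θ.sig n) θ.unhitLo θ.coreLen 0 n
  else if μ.st.phase = q then
    loPot θ.η (θ.sig n) θ.unhitLo θ.coreLen (μ.corePairs (preDepth α ε dcore q)).card
      (μ.unhit (preDepth α ε dcore q)).card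
  else 0

/-- The potential for `BadWeight`. -/
noncomputable def potWeight : ℝ :=
  -- Before the phase begins, `dcore * n` stands for its still unknown initial weight.
  if μ.st.phase < q then upPot θ.lam (θ.rho n) θ.weightHi θ.coreLen 0 (dcore * n)
  else if μ.st.phase = q then
    upPot θ.lam (θ.rho n) θ.weightHi θ.coreLen (μ.corePairs (preDepth α ε dcore q)).card
      (∑ s ∈ μ.unhit (preDepth α ε dcore q), (μ.wt s : ℝ))
  else 0

/-- The total potential. -/
noncomputable def pot : ℝ :=
  ∑ q ∈ Finset.Icc 1 (lastPhase α ε dcore), (θ.potHi q μ + θ.potLo α ε dcore q μ +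
    θ.potUnhit α ε dcore q μ + θ.potWeight α ε dcore q μ)

theorem potHi_nonneg : 0 ≤ θ.potHi q μ := upPot_nonneg _ _ _ _ _ _

theorem potLo_nonneg : 0 ≤ θ.potLo α ε dcore q μ := loPot_nonneg _ _ _ _ _ _

theorem potUnhit_nonneg : 0 ≤ θ.potUnhit α ε dcore q μ := by
  unfold potUnhit
  split_ifs
  · exact loPot_nonneg _ _ _ _ _ _
  · exact loPot_nonneg _ _ _ _ _ _
  · exact le_rfl

theorem potWeight_nonneg : 0 ≤ θ.potWeight α ε dcore q μ := by
  unfold potWeight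
  split_ifs
  · exact upPot_nonneg _ _ _ _ _ _
  · exact upPot_nonneg _ _ _ _ _ _
  · exact le_rfl

/-- The conditions on the parameters under which the potentials are supermartingales. -/
structure Valid : Prop where
  two_le : 2 ≤ n
  η_nonneg : 0 ≤ θ.η
  η_le : θ.η ≤ 1
  lam_nonneg : 0 ≤ θ.lam
  lam_mul_le : θ.lam * numHashes α ε ≤ θ.η
  freeLo_le : ∀ q, 1 ≤ q → (n : ℝ) - target n α ε dcore q ≤ θ.freeLo (q + 1)

variable {θ α ε dcore μ q}

theorem sig_nonneg (hθ : θ.Valid (n := n) α ε dcore) : 0 ≤ θ.sig n := by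
  have : (2 : ℝ) ≤ n := by exact_mod_cast hθ.two_le
  have : (1 + θ.η) / n ≤ 1 := (div_le_one (by linarith)).2 (by linarith [hθ.η_le])
  unfold sig; linarith

theorem sig_le_one (hθ : θ.Valid (n := n) α ε dcore) : θ.sig n ≤ 1 := by
  have : 0 ≤ (1 + θ.η) / n := div_nonneg (by linarith [hθ.η_nonneg]) (Nat.cast_nonneg _)
  unfold sig; linarith

theorem one_le_loPot (hθ : θ.Valid (n := n) α ε dcore) {M m : ℕ} {X b : ℝ} (hm : m ≤ M)
    (hX0 : 0 ≤ X) (hX : X ≤ b) : 1 ≤ loPot θ.η (θ.sig n) b M m X := by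
  unfold loPot
  rw [if_pos hm]
  refine Real.one_le_exp (mul_nonneg hθ.η_nonneg ?_)
  have := mul_le_of_le_one_left hX0 (pow_le_one₀ (n := M - m) (sig_nonneg hθ) (sig_le_one hθ))
  linarith

theorem one_le_upPot {lam rho : ℝ} (hlam : 0 ≤ lam) {M m : ℕ} {X a : ℝ} (hm : M ≤ m)
    (hX : a ≤ X) : 1 ≤ upPot lam rho a M m X := by
  unfold upPot
  rw [Nat.sub_eq_zero_of_le hm, pow_zero, one_mul]
  exact Real.one_le_exp (mul_nonneg hlam (by linarith))

theorem one_le_pot (hθ : θ.Valid (n := n) α ε dcore) (hB : θ.Bad α ε dcore μ) :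
    1 ≤ θ.pot α ε dcore μ := by
  obtain ⟨q, hq, h⟩ := hB
  have h1 := θ.potHi_nonneg q μ
  have h2 := θ.potLo_nonneg α ε dcore q μ
  have h3 := θ.potUnhit_nonneg α ε dcore q μ
  have h4 := θ.potWeight_nonneg α ε dcore q μ
  refine le_trans ?_ (Finset.single_le_sum (f := fun q => θ.potHi q μ + θ.potLo α ε dcore q μ +
    θ.potUnhit α ε dcore q μ + θ.potWeight α ε dcore q μ) (fun q _ => ?_) hq)
  · rcases h with ⟨ha, hb⟩ | ⟨ha, hb⟩ | ⟨ha, hb, hc⟩ | ⟨ha, hb, hc⟩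
    · have : 1 ≤ θ.potHi q μ := one_le_upPot hθ.η_nonneg ha hb
      linarith
    · have : 1 ≤ θ.potLo α ε dcore q μ := one_le_loPot hθ ha (Nat.cast_nonneg _) hb
      linarith
    · have : 1 ≤ θ.potUnhit α ε dcore q μ := by
        unfold potUnhit
        rw [if_neg ha.not_lt, if_pos ha]
        exact one_le_loPot hθ hb (Nat.cast_nonneg _) hc
      linarith
    · have : 1 ≤ θ.potWeight α ε dcore q μ := by
        unfold potWeight
        rw [if_neg ha.not_lt, if_pos ha]
        exact one_le_upPot hθ.lam_nonneg hb hc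
      linarith
  · have h1 := θ.potHi_nonneg q μ
    have h2 := θ.potLo_nonneg α ε dcore q μ
    have h3 := θ.potUnhit_nonneg α ε dcore q μ
    have h4 := θ.potWeight_nonneg α ε dcore q μ
    linarith

section steps
variable {L : ℕ} {k : Fin dcore} {p : ℕ × ℕ}

theorem pot_congr {μ' : Micro n} (h1 : μ'.seen = μ.seen) (h2 : μ'.val = μ.val)
    (h3 : μ'.wt = μ.wt) (h4 : μ'.st.phase = μ.st.phase) :
    θ.pot α ε dcore μ' = θ.pot α ε dcore μ := by
  unfold pot potHi potLo potUnhit potWeight Micro.unhit Micro.free Micro.corePairs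
  rw [h1, h2, h3, h4]

/-- The potential depends only on the memory, the reference weights and the phase, none of which
changes when a known hash is read again. -/
theorem pot_next_known (hq : microQuery α ε L μ k = some p) (hp : p ∈ μ.seen) :
    θ.pot α ε dcore (microNext α ε μ k (μ.val p)) = θ.pot α ε dcore μ := by
  refine pot_congr ?_ ?_ (microNext_wt _) (microNext_phase _)
  · rw [microNext_seen hq, Finset.insert_eq_of_mem hp]
  · rw [microNext_val hq, Function.update_eq_self]

theorem image_update_insert {R : Finset (ℕ × ℕ)} {g : ℕ × ℕ → Fin n} (hp : p ∉ R) (v : Fin n) :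
    ((insert p R).image (Function.update g p v))ᶜ = ((R.image g)ᶜ).erase v := by
  have : R.image (Function.update g p v) = R.image g := by
    refine Finset.image_congr fun r hr => Function.update_of_ne ?_ _ _
    rintro rfl; exact hp hr
  rw [Finset.image_insert, Function.update_self, this, Finset.compl_insert]

/-- A fresh hash deletes a uniform slot from `free`, and also from `unhit` if its index is in the
core. Each summand is then an instance of `sum_upPot_le` or `sum_loPot_le`, or is unchanged. -/
theorem sum_pot_next_le (hθ : θ.Valid (n := n) α ε dcore) (hI : μ.Inv α ε dcore)
    (hq : microQuery α ε L μ k = some p) (hp : p ∉ μ.seen) :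
    ∑ v, θ.pot α ε dcore (microNext α ε μ k v) ≤ n * θ.pot α ε dcore μ := by
  have hn1 : 1 ≤ n := by have := hθ.two_le; omega
  have hseen : ∀ v, (microNext α ε μ k v).seen.card = μ.seen.card + 1 := fun v => by
    rw [microNext_seen hq, Finset.card_insert_of_notMem hp]
  have hfree : ∀ v, (microNext α ε μ k v).free = μ.free.erase v := fun v => by
    unfold Micro.free
    rw [microNext_seen hq, microNext_val hq, image_update_insert hp]
  have hcoreIn : ∀ J v, J < p.2 →
      (microNext α ε μ k v).corePairs J = insert p (μ.corePairs J) := fun J v h => by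
    unfold Micro.corePairs
    rw [microNext_seen hq, Finset.filter_insert, if_pos h]
  have hpc : ∀ J, p ∉ μ.corePairs J := fun J h => hp (Finset.mem_filter.1 h).1
  have hcoreCard : ∀ J v, J < p.2 →
      ((microNext α ε μ k v).corePairs J).card = (μ.corePairs J).card + 1 := fun J v h => by
    rw [hcoreIn J v h, Finset.card_insert_of_notMem (hpc J)]
  have hunhit : ∀ J v, J < p.2 →
      (microNext α ε μ k v).unhit J = (μ.unhit J).erase v := fun J v h => by
    unfold Micro.unhit
    rw [hcoreIn J v h, microNext_val hq, image_update_insert (hpc J)]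
  have hcoreOut : ∀ J v, ¬ J < p.2 →
      (microNext α ε μ k v).corePairs J = μ.corePairs J := fun J v h => by
    unfold Micro.corePairs
    rw [microNext_seen hq, Finset.filter_insert, if_neg h]
  have hunhitOut : ∀ J v, ¬ J < p.2 →
      (microNext α ε μ k v).unhit J = μ.unhit J := fun J v h => by
    unfold Micro.unhit
    rw [hcoreOut J v h, microNext_val hq]
    congr 1
    refine Finset.image_congr fun r hr => Function.update_of_ne ?_ _ _
    rintro rfl; exact hpc J hr
  unfold pot
  rw [Finset.sum_comm, Finset.mul_sum]
  refine Finset.sum_le_sum fun q hqq => ?_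
  rw [Finset.sum_add_distrib, Finset.sum_add_distrib, Finset.sum_add_distrib, mul_add, mul_add,
    mul_add]
  refine add_le_add (add_le_add (add_le_add ?_ ?_) ?_) ?_
  · unfold potHi rho
    simp only [hseen, hfree]
    have := sum_upPot_le hn1 (θ.freeHi q) hθ.η_nonneg hθ.η_nonneg hθ.η_le (B := 1)
      (by rw [mul_one]) (fun _ : Fin n => (1 : ℝ)) (fun _ => zero_le_one) (fun _ => le_rfl)
      (θ.lenHi q) μ.seen.card μ.free
    simpa only [Finset.sum_const, nsmul_eq_mul, mul_one] using this
  · unfold potLo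
    simp only [hseen, hfree]
    exact sum_loPot_le hθ.two_le _ hθ.η_nonneg hθ.η_le _ _ _
  · unfold potUnhit
    simp only [microNext_phase]
    split_ifs with h1 h2
    · simp
    · by_cases hJ : preDepth α ε dcore q < p.2
      · simp only [hcoreCard _ _ hJ, hunhit _ _ hJ]
        exact sum_loPot_le hθ.two_le _ hθ.η_nonneg hθ.η_le _ _ _
      · simp [hcoreOut _ _ hJ, hunhitOut _ _ hJ]
    · simp
  · unfold potWeight
    simp only [microNext_phase, microNext_wt]
    split_ifs with h1 h2
    · simp
    · by_cases hJ : preDepth α ε dcore q < p.2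
      · simp only [hcoreCard _ _ hJ, hunhit _ _ hJ]
        refine sum_upPot_le hn1 _ hθ.lam_nonneg hθ.η_nonneg hθ.η_le hθ.lam_mul_le _
          (fun _ => Nat.cast_nonneg _) (fun s => ?_) _ _ _
        have hD : preDepth α ε dcore μ.st.phase ≤ numHashes α ε :=
          (Nat.sub_le _ _).trans (dMax_le_numHashes hI.phase_le)
        exact_mod_cast (hI.wt_le s).trans hD
      · simp [hcoreOut _ _ hJ, hunhitOut _ _ hJ]
    · simp

/-- Only a change of phase matters: the provisional weight `dcore * n` is replaced by the true one.
That this is no larger is where the absence of `BadLo` enters. -/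
theorem pot_silent_le [NeZero n] (hθ : θ.Valid (n := n) α ε dcore) (hI : μ.Inv α ε dcore)
    (hB : ¬ θ.Bad α ε dcore μ) (hq : microQuery α ε L μ k = none) :
    θ.pot α ε dcore (microSilent α ε L μ k) ≤ θ.pot α ε dcore μ := by
  obtain ⟨h1, h2, -, h⟩ := microSilent_cases hq
  rcases h with ⟨hw, b, hst⟩ | ⟨hcomp, hlt, hst, hw⟩ | ⟨-, -, hw, hst⟩
  · exact (pot_congr h1 h2 hw (by rw [hst])).le
  · have hfr : (microSilent α ε L μ k).free = μ.free := by unfold Micro.free; rw [h1, h2]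
    have hcp : ∀ J, (microSilent α ε L μ k).corePairs J = μ.corePairs J := fun J => by
      unfold Micro.corePairs; rw [h1]
    have huh : ∀ J, (microSilent α ε L μ k).unhit J = μ.unhit J := fun J => by
      unfold Micro.unhit; rw [hcp, h2]
    have hph : (microSilent α ε L μ k).st.phase = μ.st.phase + 1 := by rw [hst]
    have hcore : μ.corePairs (preDepth α ε dcore (μ.st.phase + 1)) = ∅ := by
      refine Finset.filter_eq_empty_iff.2 fun p hp => ?_
      rw [preDepth_succ, not_lt]
      exact (hI.seen_bd p hp).2.1
    have hunh : μ.unhit (preDepth α ε dcore (μ.st.phase + 1)) = Finset.univ := by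
      unfold Micro.unhit; rw [hcore]; simp
    refine Finset.sum_le_sum fun q hqq => ?_
    refine add_le_add (add_le_add (add_le_add ?_ ?_) ?_) ?_
    · unfold potHi; rw [h1, hfr]
    · unfold potLo; rw [h1, hfr]
    · have h0 := θ.potUnhit_nonneg α ε dcore q μ
      unfold potUnhit at h0 ⊢
      rw [hph, hcp, huh]
      by_cases hq1 : μ.st.phase + 1 < q
      · rw [if_pos hq1, if_pos (by omega)]
      · rw [if_neg hq1]
        by_cases hq2 : μ.st.phase + 1 = q
        · rw [if_pos hq2, if_pos (by omega), ← hq2, hcore, hunh]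
          simp
        · rw [if_neg hq2]; exact h0
    · have h0 := θ.potWeight_nonneg α ε dcore q μ
      unfold potWeight at h0 ⊢
      rw [hph, hcp, huh]
      by_cases hq1 : μ.st.phase + 1 < q
      · rw [if_pos hq1, if_pos (by omega)]
      · rw [if_neg hq1]
        by_cases hq2 : μ.st.phase + 1 = q
        · rw [if_pos hq2, if_pos (by omega), ← hq2, hcore, hunh, hw]
          unfold upPot
          refine Real.exp_le_exp.2 (mul_le_mul_of_nonneg_left ?_ hθ.lam_nonneg)
          have hrho : 0 ≤ θ.rho n := by
            have : (2 : ℝ) ≤ n := by exact_mod_cast hθ.two_le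
            have : (1 - θ.η) / n ≤ 1 :=
              (div_le_one (by linarith)).2 (by linarith [hθ.η_nonneg])
            unfold rho; linarith
          rw [Finset.card_empty]
          refine sub_le_sub_right (mul_le_mul_of_nonneg_left ?_ (pow_nonneg hrho _)) _
          set J := preDepth α ε dcore (μ.st.phase + 1) with hJ
          have hfree : (μ.free.card : ℝ) ≤ θ.freeLo (μ.st.phase + 1) := by
            refine le_trans ?_ (hθ.freeLo_le _ hI.phase_pos)
            have ha : (μ.free.card : ℝ) + μ.st.count ≤ n := by
              exact_mod_cast hI.free_add_count_le hcomp.1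
            have hb : (target n α ε dcore μ.st.phase : ℝ) ≤ μ.st.count := by
              exact_mod_cast hcomp.2
            linarith
          -- The completed phase left few free slots, so without `BadLo` there were many
          -- examinations.
          have hlen : (J - dcore) * n < μ.seen.card := by
            by_contra hle
            exact hB ⟨μ.st.phase + 1, Finset.mem_Icc.2 ⟨by omega, hlt⟩,
              Or.inr (Or.inl ⟨not_lt.1 hle, hfree⟩)⟩
          have hsum := hI.sum_weight_le hcomp.1 J
          have hall : μ.seen.filter (fun p => p.2 ≤ J) = μ.seen := by
            refine Finset.filter_true_of_mem fun p hp => ?_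
            rw [hJ, preDepth_succ]
            exact (hI.seen_bd p hp).2.1
          -- Total weight plus number of examinations is at most Jn, so fewer than d_core·n units of
          -- weight remain.
          rw [hall] at hsum
          have hJd : J * n ≤ (J - dcore) * n + dcore * n := by
            rw [← add_mul]; exact Nat.mul_le_mul_right _ (by omega)
          have : ∑ s, weight J μ.st.table μ.seen s ≤ dcore * n := by omega
          exact_mod_cast this
        · rw [if_neg hq2]; exact h0
  · exact (pot_congr h1 h2 hw (by rw [hst])).le

end steps

/-- If none of the unlikely events occurs, then there are few core elements. -/
theorem coreCount_le (hI : μ.Inv α ε dcore) (hB : ¬ θ.Bad α ε dcore μ)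
    (hfree : ∀ q, 1 ≤ q → θ.freeHi q ≤ (n : ℝ) - target n α ε dcore q)
    (hlen : ∀ q, 1 ≤ q →
      (θ.lenHi q : ℝ) + θ.weightHi ≤ preDepth α ε dcore q * n + θ.coreLen) :
    (μ.st.coreCount α ε dcore : ℝ) ≤ n + 1 - θ.unhitLo := by
  set q := μ.st.phase with hq
  have hqq : q ∈ Finset.Icc 1 (lastPhase α ε dcore) := Finset.mem_Icc.2 ⟨hI.phase_pos, hI.phase_le⟩
  -- The target caps the number of keys, so many slots are free; by the absence of `BadHi`, few
  -- pairs have been examined.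
  have hseen : μ.seen.card < θ.lenHi q := by
    by_contra hle
    refine hB ⟨q, hqq, Or.inl ⟨not_lt.1 hle, (hfree q hI.phase_pos).trans ?_⟩⟩
    have h1 : (n : ℝ) ≤ μ.free.card + μ.st.count := by exact_mod_cast hI.le_free_add_count
    have h2 : (μ.st.count : ℝ) ≤ target n α ε dcore q := by exact_mod_cast hI.count_le
    linarith
  -- More than `coreLen` core examinations would leave weight below `weightHi`, and the counting
  -- inequality would then force more examinations in total than `lenHi`.
  have hP : (μ.corePairs (preDepth α ε dcore q)).card ≤ θ.coreLen := by
    by_contra hlt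
    have hW : ∑ s ∈ μ.unhit (preDepth α ε dcore q), (μ.wt s : ℝ) < θ.weightHi := by
      by_contra hle
      exact hB ⟨q, hqq, Or.inr (Or.inr (Or.inr ⟨rfl, by omega, not_lt.1 hle⟩))⟩
    have h1 : (preDepth α ε dcore q * n + (μ.corePairs (preDepth α ε dcore q)).card : ℝ) ≤
        ∑ s ∈ μ.unhit (preDepth α ε dcore q), (μ.wt s : ℝ) + μ.seen.card := by
      exact_mod_cast hI.mul_add_card_le
    have h2 : (θ.coreLen : ℝ) ≤ (μ.corePairs (preDepth α ε dcore q)).card := by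
      exact_mod_cast (not_le.1 hlt).le
    have h3 : (μ.seen.card : ℝ) ≤ θ.lenHi q := by exact_mod_cast hseen.le
    linarith [hlen q hI.phase_pos]
  have hU : θ.unhitLo < (μ.unhit (preDepth α ε dcore q)).card := by
    by_contra hle
    exact hB ⟨q, hqq, Or.inr (Or.inr (Or.inl ⟨rfl, hP, not_lt.1 hle⟩))⟩
  have h1 : (μ.st.coreCount α ε dcore : ℝ) + (μ.unhit (preDepth α ε dcore q)).card ≤ n + 1 := by
    exact_mod_cast hI.coreCount_add_unhit_le
  linarith

end Thresholds

/-! ### Probability of the unlikely events -/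

namespace Thresholds
variable {θ : Thresholds} {α ε : ℝ} {dcore : ℕ}

theorem infinitePi_bad_le [NeZero n] [NeZero dcore] (hθ : θ.Valid (n := n) α ε dcore)
    (hlast : 1 ≤ lastPhase α ε dcore) (L : ℕ) (κ : ℕ → Fin dcore) :
    Measure.infinitePi (fun _ : ℕ × ℕ => uniformOn (Set.univ : Set (Fin n)))
      {h | ∃ T, θ.Bad α ε dcore (microRun α ε L h κ T)} ≤
      ENNReal.ofReal (θ.pot α ε dcore (microInit (n := n) α ε dcore)) := by
  have hU : {h : ℕ × ℕ → Fin n | ∃ T, θ.Bad α ε dcore (microRun α ε L h κ T)} =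
      ⋃ T : ℕ, {h | ∃ t ≤ T, θ.Bad α ε dcore (microRun α ε L h κ t)} := by
    ext h
    simp only [Set.mem_ofPred_eq, Set.mem_iUnion]
    exact ⟨fun ⟨T, hT⟩ => ⟨T, T, le_rfl, hT⟩, fun ⟨T, t, _, ht⟩ => ⟨t, ht⟩⟩
  have hmono : Monotone fun T : ℕ =>
      {h : ℕ × ℕ → Fin n | ∃ t ≤ T, θ.Bad α ε dcore (microRun α ε L h κ t)} :=
    fun T T' hTT h ⟨t, ht, hb⟩ => ⟨t, ht.trans hTT, hb⟩
  rw [hU, hmono.measure_iUnion]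
  refine iSup_le fun T => ?_
  have hn0 : (n : ENNReal) ≠ 0 := by exact_mod_cast NeZero.ne n
  have key := explore_hit_le (ι := ℕ × ℕ) (V := Fin n) (microQuery α ε L) (microSilent α ε L)
    (microNext α ε) Micro.time Micro.seen Micro.val (Micro.Inv α ε dcore) (θ.Bad α ε dcore)
    (fun μ => ENNReal.ofReal (θ.pot α ε dcore μ)) κ
    (fun μ k hq => ⟨(microSilent_cases hq).1, (microSilent_cases hq).2.1⟩)
    (fun μ k p v hq => ⟨microNext_seen hq v, microNext_val hq v⟩)
    (fun μ _ hb => by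
      rw [← ENNReal.ofReal_one]
      exact ENNReal.ofReal_le_ofReal (one_le_pot hθ hb))
    (fun μ k hI hq => hI.silent hq)
    (fun μ k p v hI hq hv => hI.next hq hv)
    (fun μ k hI hb hq => ENNReal.ofReal_le_ofReal (pot_silent_le hθ hI hb hq))
    (fun μ k p _ _ hq hp => (congrArg ENNReal.ofReal (pot_next_known hq hp)).le)
    (fun μ k p hI _ hq hp => by
      rw [Fintype.card_fin]
      refine ENNReal.div_le_of_le_mul ?_
      rw [← ENNReal.ofReal_sum_of_nonneg, ← ENNReal.ofReal_natCast, mul_comm,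
        ← ENNReal.ofReal_mul (Nat.cast_nonneg _)]
      · exact ENNReal.ofReal_le_ofReal (sum_pot_next_le hθ hI hq hp)
      · intro v _
        refine Finset.sum_nonneg fun q _ => ?_
        have h1 := θ.potHi_nonneg q (microNext α ε μ k v)
        have h2 := θ.potLo_nonneg α ε dcore q (microNext α ε μ k v)
        have h3 := θ.potUnhit_nonneg α ε dcore q (microNext α ε μ k v)
        have h4 := θ.potWeight_nonneg α ε dcore q (microNext α ε μ k v)
        linarith)
    (fun B T s => by
      have hm := measurableSet_explore (microQuery α ε L) (microSilent α ε L)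
        (microNext (n := n) (dcore := dcore) α ε) Micro.time B T s
      exact (measurable_id.prodMk measurable_const : Measurable
        fun h : ℕ × ℕ → Fin n => (h, κ)) hm)
    T (microInit α ε dcore) (microInit_inv hlast)
  have e : ∀ h : ℕ × ℕ → Fin n, (microInit (n := n) α ε dcore).seen.piecewise
      (microInit (n := n) α ε dcore).val h = h := fun h => by
    ext p; simp [Finset.piecewise, microInit]
  simp only [e] at key
  exact key

/-- The bound for fixed random numbers `κ` does not depend on `κ`, so it survives integration by
Fubini. -/
theorem law_bad_le [NeZero n] [NeZero dcore] (hθ : θ.Valid (n := n) α ε dcore)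
    (hlast : 1 ≤ lastPhase α ε dcore) (L : ℕ) :
    law n dcore {ω | ∃ T, θ.Bad α ε dcore (microRun α ε L ω.1 ω.2 T)} ≤
      ENNReal.ofReal (θ.pot α ε dcore (microInit (n := n) α ε dcore)) := by
  have hmeas : MeasurableSet {ω : Sample n dcore | ∃ T, θ.Bad α ε dcore
      (microRun α ε L ω.1 ω.2 T)} := by
    have : {ω : Sample n dcore | ∃ T, θ.Bad α ε dcore (microRun α ε L ω.1 ω.2 T)} =
        ⋃ T : ℕ, {ω | explore (microQuery α ε L) (microSilent α ε L) (microNext α ε) Micro.time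
          ω.1 ω.2 T (microInit α ε dcore) ∈ {μ | θ.Bad α ε dcore μ}} := by
      ext ω; simp [microRun]
    rw [this]
    exact MeasurableSet.iUnion fun T => measurableSet_explore _ _ _ _ _ _ _
  unfold law
  rw [Measure.prod_apply_symm hmeas]
  refine (lintegral_mono fun κ => infinitePi_bad_le hθ hlast L κ).trans ?_
  rw [lintegral_const, measure_univ, mul_one]

theorem one_sub_pot_le [NeZero n] [NeZero dcore] (hθ : θ.Valid (n := n) α ε dcore)
    (hlast : 1 ≤ lastPhase α ε dcore) (L : ℕ)
    (hfree : ∀ q, 1 ≤ q → θ.freeHi q ≤ (n : ℝ) - target n α ε dcore q)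
    (hlen : ∀ q, 1 ≤ q →
      (θ.lenHi q : ℝ) + θ.weightHi ≤ preDepth α ε dcore q * n + θ.coreLen) :
    1 - θ.pot α ε dcore (microInit (n := n) α ε dcore) ≤
      (law n dcore).real {ω | ∀ t : ℕ,
        ((run α ε L ω t).coreCount α ε dcore : ℝ) ≤ n + 1 - θ.unhitLo} := by
  set G : Set (Sample n dcore) := {ω | ∀ t : ℕ,
        ((run α ε L ω t).coreCount α ε dcore : ℝ) ≤ n + 1 - θ.unhitLo} with hG
  set B : Set (Sample n dcore) := {ω | ∃ T, θ.Bad α ε dcore (microRun α ε L ω.1 ω.2 T)} with hB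
  have : IsProbabilityMeasure (law n dcore) := by unfold law; infer_instance
  have hcover : (Set.univ : Set (Sample n dcore)) ⊆ G ∪ B := by
    intro ω _
    by_cases hω : ω ∈ B
    · exact Or.inr hω
    · left
      intro t
      obtain ⟨T, hT⟩ := exists_microRun_time_eq (α := α) (ε := ε) (L := L) (h := ω.1) (κ := ω.2) t
      have hst := microRun_st (α := α) (ε := ε) (L := L) (h := ω.1) (κ := ω.2) T
      rw [hT] at hst
      rw [show run α ε L ω t = run α ε L (ω.1, ω.2) t from rfl, ← hst]
      exact coreCount_le (microRun_inv hlast T).1 (fun h => hω ⟨T, h⟩) hfree hlen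
  have h1 : 1 ≤ (law n dcore).real G + (law n dcore).real B := by
    rw [← probReal_univ (μ := law n dcore)]
    exact (measureReal_mono hcover).trans (measureReal_union_le _ _)
  have hpot : 0 ≤ θ.pot α ε dcore (microInit (n := n) α ε dcore) := by
    refine Finset.sum_nonneg fun q _ => ?_
    have h1 := θ.potHi_nonneg q (microInit (n := n) α ε dcore)
    have h2 := θ.potLo_nonneg α ε dcore q (microInit (n := n) α ε dcore)
    have h3 := θ.potUnhit_nonneg α ε dcore q (microInit (n := n) α ε dcore)
    have h4 := θ.potWeight_nonneg α ε dcore q (microInit (n := n) α ε dcore)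
    linarith
  have h2 : (law n dcore).real B ≤ θ.pot α ε dcore (microInit (n := n) α ε dcore) :=
    ENNReal.toReal_le_of_le_ofReal hpot (law_bad_le hθ hlast L)
  linarith

/-- A union bound over the phases and the four events; `y` is a common lower bound for the
exponents. -/
theorem pot_init_le [NeZero n] [NeZero dcore] (hθ : θ.Valid (n := n) α ε dcore) {y : ℝ}
    (h1 : ∀ q ∈ Finset.Icc 1 (lastPhase α ε dcore),
      θ.η * (θ.rho n ^ θ.lenHi q * n - θ.freeHi q) ≤ -y)
    (h2 : ∀ q ∈ Finset.Icc 1 (lastPhase α ε dcore),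
      θ.η * (θ.freeLo q - θ.sig n ^ ((preDepth α ε dcore q - dcore) * n) * n) ≤ -y)
    (h3 : θ.η * (θ.unhitLo - θ.sig n ^ θ.coreLen * n) ≤ -y)
    (h4 : θ.lam * (θ.rho n ^ θ.coreLen * (dcore * n) - θ.weightHi) ≤ -y) :
    θ.pot α ε dcore (microInit (n := n) α ε dcore) ≤
      lastPhase α ε dcore * (4 * Real.exp (-y)) := by
  have hfree : (microInit (n := n) α ε dcore).free = Finset.univ := by
    simp [Micro.free, microInit]
  have hcore : ∀ J, (microInit (n := n) α ε dcore).corePairs J = ∅ := by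
    simp [Micro.corePairs, microInit]
  have hunhit : ∀ J, (microInit (n := n) α ε dcore).unhit J = Finset.univ := by
    simp [Micro.unhit, hcore]
  have hcard : (lastPhase α ε dcore : ℝ) * (4 * Real.exp (-y)) =
      ∑ _q ∈ Finset.Icc 1 (lastPhase α ε dcore), 4 * Real.exp (-y) := by
    simp
  rw [hcard]
  refine Finset.sum_le_sum fun q hq => ?_
  have hq1 := (Finset.mem_Icc.1 hq).1
  have e1 : θ.potHi q (microInit (n := n) α ε dcore) ≤ Real.exp (-y) := by
    unfold potHi upPot
    rw [hfree]
    simpa [microInit] using h1 q hq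
  have e2 : θ.potLo α ε dcore q (microInit (n := n) α ε dcore) ≤ Real.exp (-y) := by
    unfold potLo loPot
    rw [hfree]
    simpa [microInit] using h2 q hq
  have e3 : θ.potUnhit α ε dcore q (microInit (n := n) α ε dcore) ≤ Real.exp (-y) := by
    unfold potUnhit loPot
    rw [hcore, hunhit]
    have hp : (microInit (n := n) α ε dcore).st.phase = 1 := rfl
    by_cases hlt : 1 < q
    · rw [hp, if_pos hlt]; simpa using h3
    · rw [hp, if_neg hlt, if_pos (by omega)]; simpa using h3
  have e4 : θ.potWeight α ε dcore q (microInit (n := n) α ε dcore) ≤ Real.exp (-y) := by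
    unfold potWeight upPot
    rw [hcore, hunhit]
    have hp : (microInit (n := n) α ε dcore).st.phase = 1 := rfl
    by_cases hlt : 1 < q
    · rw [hp, if_pos hlt]; simpa using h4
    · rw [hp, if_neg hlt, if_pos (by omega)]
      refine Real.exp_le_exp.2 (le_trans ?_ h4)
      refine mul_le_mul_of_nonneg_left ?_ hθ.lam_nonneg
      have hrho : 0 ≤ θ.rho n := by
        have : (2 : ℝ) ≤ n := by exact_mod_cast hθ.two_le
        have : (1 - θ.η) / n ≤ 1 :=
          (div_le_one (by linarith)).2 (by linarith [hθ.η_nonneg])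
        unfold rho; linarith
      rw [Finset.card_empty, Nat.sub_zero]
      refine sub_le_sub_right (mul_le_mul_of_nonneg_left ?_ (pow_nonneg hrho _)) _
      -- In phase 1 the depth is γ < d_core, so the initial weight is γn without any appeal to
      -- concentration.
      have hJ : preDepth α ε dcore 1 ≤ dcore := by
        unfold preDepth dMax gam
        have := Nat.mod_lt (numHashes α ε) (Nat.pos_of_ne_zero (NeZero.ne dcore))
        omega
      have : ∑ s : Fin n, ((microInit (n := n) α ε dcore).wt s : ℝ) =
          n * preDepth α ε dcore 1 := by simp [microInit]
      rw [this, mul_comm]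
      gcongr
  linarith

end Thresholds

/-! ### Numerical estimates for the four gaps -/

theorem one_sub_div_pow_le {n : ℕ} (hn : 1 ≤ n) {η x : ℝ} (hη0 : 0 ≤ η) (hη1 : η ≤ 1) {M : ℕ}
    (hM : x * n ≤ M) : (1 - (1 - η) / n) ^ M ≤ Real.exp (-((1 - η) * x)) := by
  have hnR : (1 : ℝ) ≤ n := by exact_mod_cast hn
  have h0 : 0 ≤ 1 - (1 - η) / (n : ℝ) := by
    have : (1 - η) / n ≤ 1 := (div_le_one (by linarith)).2 (by linarith)
    linarith
  calc (1 - (1 - η) / n) ^ M ≤ Real.exp (-((1 - η) / n)) ^ M :=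
        pow_le_pow_left₀ h0 (Real.one_sub_le_exp_neg _) _
    _ = Real.exp (-((1 - η) * (M / n))) := by
        rw [← Real.exp_nat_mul]; congr 1; ring
    _ ≤ _ := by
        refine Real.exp_le_exp.2 (neg_le_neg (mul_le_mul_of_nonneg_left ?_ (by linarith)))
        rwa [le_div_iff₀ (by linarith)]

/-- For y = (1+η)/n ≤ 2/n ≤ 1/2 one has 1 - y ≥ e^(-y-2y²), and 2y² ≤ 8/n²; this is the source of
8/n. -/
theorem le_one_sub_div_pow {n : ℕ} (hn : 4 ≤ n) {η x : ℝ} (hη0 : 0 ≤ η) (hη1 : η ≤ 1) {M : ℕ}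
    (hM : (M : ℝ) ≤ x * n) : Real.exp (-((1 + η + 8 / n) * x)) ≤ (1 - (1 + η) / n) ^ M := by
  have hnR : (4 : ℝ) ≤ n := by exact_mod_cast hn
  set y : ℝ := (1 + η) / n with hy
  have hy0 : 0 ≤ y := div_nonneg (by linarith) (by linarith)
  have hy2 : y ≤ 2 / n := by rw [hy]; gcongr; linarith
  have hyh : y ≤ 1 / 2 := hy2.trans (by rw [div_le_div_iff₀ (by linarith) (by norm_num)]; linarith)
  have h1 : Real.exp (-(y + 2 * y ^ 2)) ≤ 1 - y := by
    rw [← Real.le_log_iff_exp_le (by linarith)]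
    refine le_trans ?_ (Real.one_sub_inv_le_log_of_pos (by linarith))
    have : (1 - y)⁻¹ ≤ 1 + y + 2 * y ^ 2 := by
      rw [inv_le_iff_one_le_mul₀ (by linarith)]
      nlinarith [mul_nonneg hy0 hy0, mul_nonneg (mul_nonneg hy0 hy0) (by linarith : 0 ≤ 1 / 2 - y)]
    linarith
  have h2 : y + 2 * y ^ 2 ≤ (1 + η + 8 / n) / n := by
    have : y ^ 2 ≤ (2 / n) ^ 2 := by gcongr
    have e : (1 + η + 8 / n) / n = y + 2 * (2 / n : ℝ) ^ 2 := by rw [hy]; field_simp; ring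
    rw [e]; linarith
  have hc : 0 ≤ (1 + η + 8 / n : ℝ) := by positivity
  calc Real.exp (-((1 + η + 8 / n) * x)) ≤ Real.exp (-((1 + η + 8 / n) / n)) ^ M := by
        rw [← Real.exp_nat_mul]
        refine Real.exp_le_exp.2 ?_
        have : (M : ℝ) / n ≤ x := by rwa [div_le_iff₀ (by linarith)]
        have := mul_le_mul_of_nonneg_left this hc
        have e : (M : ℝ) * -((1 + η + 8 / n) / n) = -((1 + η + 8 / n) * (M / n)) := by ring
        rw [e]; linarith
    _ ≤ (1 - y) ^ M := by
        refine pow_le_pow_left₀ (Real.exp_pos _).le (le_trans (Real.exp_le_exp.2 ?_) h1) _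
        linarith

/-- Of the slack α/8 between D - 7α/8 and D - α, half is lost to η; the rest gives the factor
e^(-α/16). The role of `w` is played by n^(3/4). -/
theorem gap_hi {n : ℕ} (hn : 1 ≤ n) {α η D gp w : ℝ} (hα0 : 0 < α) (hη0 : 0 ≤ η) (hη1 : η ≤ 1)
    (hηD : η * D ≤ α / 16) (hw : 0 ≤ w) (hwD : Real.exp (-1) * w ≤ Real.exp (-D + α) * n)
    (hgp : gp ≤ Real.exp (-1) * (1 - Real.exp (-(α / 16)))) {M : ℕ}
    (hM : (D - 7 * α / 8) * n ≤ M) :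
    (1 - (1 - η) / n) ^ M * n - (Real.exp (-D + α) * n - 1) ≤ -(gp * w - 1) := by
  have e1 := one_sub_div_pow_le hn hη0 hη1 hM
  have e2 : Real.exp (-((1 - η) * (D - 7 * α / 8))) ≤
      Real.exp (-D + α) * Real.exp (-(α / 16)) := by
    rw [← Real.exp_add]
    refine Real.exp_le_exp.2 ?_
    linarith [mul_nonneg hη0 hα0.le]
  have e4 : Real.exp (-(α / 16)) ≤ 1 := Real.exp_le_one_iff.2 (by linarith)
  have e5 : (1 - (1 - η) / n) ^ M * n ≤ Real.exp (-D + α) * Real.exp (-(α / 16)) * n := by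
    gcongr; exact e1.trans e2
  have e6 := mul_le_mul_of_nonneg_right hwD (by linarith : 0 ≤ 1 - Real.exp (-(α / 16)))
  have e7 := mul_le_mul_of_nonneg_right hgp hw
  linarith

/-- The slack is d - α ≥ 1 - α > 0: (J-d)n examinations are too few to leave only e^(-J+α)·n free
slots. -/
theorem gap_lo {n : ℕ} (hn : 4 ≤ n) {α η J d gp w : ℝ} (hα1 : α < 1) (hη0 : 0 ≤ η) (hη1 : η ≤ 1)
    (hd : 1 ≤ d) (hηJ : η * (J - d) ≤ (1 - α) / 16) (hnJ : 8 / n * (J - d) ≤ (1 - α) / 16)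
    (hw : 0 ≤ w) (hwJ : Real.exp (-1) * w ≤ Real.exp (-J + α) * n)
    (hgp : gp ≤ Real.exp (-1) * ((1 - α) / 2)) {M : ℕ} (hM : (M : ℝ) ≤ (J - d) * n) :
    Real.exp (-J + α) * n - (1 - (1 + η) / n) ^ M * n ≤ -(gp * w - 1) := by
  have e1 := le_one_sub_div_pow hn hη0 hη1 hM
  have e2 : Real.exp (-J + α) * (1 + (1 - α) / 2) ≤
      Real.exp (-((1 + η + 8 / n) * (J - d))) := by
    calc Real.exp (-J + α) * (1 + (1 - α) / 2)
        ≤ Real.exp (-J + α) * Real.exp ((1 - α) / 2) := by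
          gcongr; linarith [Real.add_one_le_exp ((1 - α) / 2)]
      _ = Real.exp (-J + α + (1 - α) / 2) := (Real.exp_add _ _).symm
      _ ≤ _ := by
        refine Real.exp_le_exp.2 ?_
        have : (1 + η + 8 / n) * (J - d) = (J - d) + η * (J - d) + 8 / n * (J - d) := by ring
        rw [this]; linarith
  have e5 : Real.exp (-J + α) * (1 + (1 - α) / 2) * n ≤ (1 - (1 + η) / n) ^ M * n := by
    gcongr; exact e2.trans e1
  have e6 := mul_le_mul_of_nonneg_right hwJ (by linarith : 0 ≤ (1 - α) / 2)
  have e7 := mul_le_mul_of_nonneg_right hgp hw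
  linarith

/-- From the exponent -d + 3α/8, at most α/16 is lost to η and α/16 to 8/n, leaving e^(-d+α/4),
which must exceed ε_core. -/
theorem gap_unhit {n : ℕ} (hn : 4 ≤ n) {α η d gp w εcore : ℝ} (hη0 : 0 ≤ η)
    (hη1 : η ≤ 1) (hηd : η * (d - 3 * α / 8) ≤ α / 16) (hnd : 8 / n * (d - 3 * α / 8) ≤ α / 16)
    (hwn : w ≤ n) (hgp0 : 0 ≤ gp) (hgp : gp ≤ Real.exp (-d + α / 4) - εcore) {M : ℕ}
    (hM : (M : ℝ) ≤ (d - 3 * α / 8) * n) :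
    εcore * n + 1 - (1 - (1 + η) / n) ^ M * n ≤ -(gp * w - 1) := by
  have e1 := le_one_sub_div_pow hn hη0 hη1 hM
  have e2 : Real.exp (-d + α / 4) ≤ Real.exp (-((1 + η + 8 / n) * (d - 3 * α / 8))) := by
    refine Real.exp_le_exp.2 ?_
    have : (1 + η + 8 / n) * (d - 3 * α / 8) =
      (d - 3 * α / 8) + η * (d - 3 * α / 8) + 8 / n * (d - 3 * α / 8) := by ring
    rw [this]; linarith
  have e5 : Real.exp (-d + α / 4) * n ≤ (1 - (1 + η) / n) ^ M * n := by
    gcongr; exact e2.trans e1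
  have e6 : gp * w ≤ gp * n := by gcongr
  have e7 : gp * n ≤ (Real.exp (-d + α / 4) - εcore) * n := by gcongr
  linarith

/-- As (1-η)(d-α/2) ≥ d-α, the surviving weight is at most d·e^(-(d-α))·n ≤ αn/8, half of the
threshold αn/4. -/
theorem gap_weight {n : ℕ} (hn : 1 ≤ n) {α η d gp w : ℝ} (hα0 : 0 < α) (hη0 : 0 ≤ η)
    (hη1 : η ≤ 1) (hd : 1 ≤ d) (hηd : η * d ≤ α / 16) (h1 : d / Real.exp (d - α) ≤ α / 8)
    (hw : 0 ≤ w) (hwn : w ≤ n) (hgp : gp ≤ α / 8) {M : ℕ} (hM : (d - α / 2) * n ≤ M) :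
    (1 - (1 - η) / n) ^ M * (d * n) - α / 4 * n ≤ -(gp * w - 1) := by
  have e1 := one_sub_div_pow_le hn hη0 hη1 hM
  have e2 : Real.exp (-((1 - η) * (d - α / 2))) ≤ (Real.exp (d - α))⁻¹ := by
    rw [← Real.exp_neg]
    refine Real.exp_le_exp.2 ?_
    linarith [mul_nonneg hη0 hα0.le]
  have e3 : (1 - (1 - η) / n) ^ M * (d * n) ≤ (d / Real.exp (d - α)) * n := by
    calc (1 - (1 - η) / n) ^ M * (d * n) ≤ (Real.exp (d - α))⁻¹ * (d * n) := by
          gcongr; exact e1.trans e2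
      _ = _ := by ring
  have e4 : (d / Real.exp (d - α)) * n ≤ α / 8 * n := by gcongr
  have e6 : gp * w ≤ α / 8 * n := by gcongr
  linarith

/-! ### Choice of the thresholds and the bound for large tables -/

/-- The thresholds used in the proof. -/
noncomputable def thresholds (n : ℕ) (α ε εcore : ℝ) (dcore : ℕ) : Thresholds where
  -- Depths are at most `numHashes`, so η costs at most min(α, 1-α)/16 in any exponent. The second
  -- division, in `lam`, allows for weights as large as `numHashes`.
  η := α * (1 - α) / 16 / numHashes α ε
  lam := α * (1 - α) / 16 / numHashes α ε / numHashes α ε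
  freeHi q := Real.exp (-(dMax α ε dcore q : ℝ) + α) * n - 1
  -- No phase precedes phase 1, so nothing has to be controlled there.
  freeLo q := if q ≤ 1 then 0 else Real.exp (-(preDepth α ε dcore q : ℝ) + α) * n
  -- The budget closes because -7α/8 + α/4 = -5α/8 < -α/2; the spare α/8 pays for rounding up.
  lenHi q := ⌈((dMax α ε dcore q : ℝ) - 7 * α / 8) * n⌉₊
  coreLen := ⌈((dcore : ℝ) - α / 2) * n⌉₊
  unhitLo := εcore * n + 1
  weightHi := α / 4 * n

section
variable {α ε εcore : ℝ} {dcore : ℕ}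

theorem dcore_le_dMax {q : ℕ} (hq : 1 ≤ q) : dcore ≤ dMax α ε dcore q := by
  rw [dMax_eq_preDepth_add hq]; exact Nat.le_add_left _ _

/-- The constant in the exponent of the failure probability. -/
noncomputable def gapConst (α εcore : ℝ) (dcore : ℕ) : ℝ :=
  min (min (Real.exp (-1) * (1 - Real.exp (-(α / 16)))) (Real.exp (-1) * ((1 - α) / 2)))
    (min (Real.exp (-(dcore : ℝ) + α / 4) - εcore) (α / 8))

theorem gapConst_pos (hα0 : 0 < α) (hα1 : α < 1)
    (hε : εcore < Real.exp (-(dcore : ℝ) + α / 8)) : 0 < gapConst α εcore dcore := by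
  have h1 : Real.exp (-(α / 16)) < 1 := Real.exp_lt_one_iff.2 (by linarith)
  have h2 : Real.exp (-(dcore : ℝ) + α / 8) < Real.exp (-(dcore : ℝ) + α / 4) :=
    Real.exp_lt_exp.2 (by linarith)
  refine lt_min (lt_min ?_ ?_) (lt_min ?_ ?_)
  · exact mul_pos (Real.exp_pos _) (by linarith)
  · exact mul_pos (Real.exp_pos _) (by linarith)
  · linarith
  · linarith

theorem failure_le [NeZero n] [NeZero dcore] (hα0 : 0 < α) (hα1 : α < 1)
    (h1 : (dcore : ℝ) / Real.exp ((dcore : ℝ) - α) ≤ α / 8)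
    (hεc : εcore < Real.exp (-(dcore : ℝ) + α / 8))
    (hεn : (n : ℝ) ^ (-(1 / 4) : ℝ) ≤ ε) (hεd : ε ≤ Real.exp (-(dcore : ℝ)))
    {l : ℝ} (hl : (numHashes α ε : ℝ) ≤ l) (hn4 : 4 ≤ n) (hnα : 8 ≤ α * n)
    (hln : 8 / n * l ≤ α * (1 - α) / 16) (hgap : 1 ≤ gapConst α εcore dcore * (n : ℝ) ^ (3 / 4 : ℝ))
    (L : ℕ) :
    1 - l * (4 * Real.exp (-(α * (1 - α) / 16 / l / l *
        (gapConst α εcore dcore * (n : ℝ) ^ (3 / 4 : ℝ) - 1)))) ≤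
      (law n dcore).real {ω | ∀ t : ℕ,
        ((run α ε L ω t).coreCount α ε dcore : ℝ) ≤ (1 - εcore) * n} := by
  have hnR : (4 : ℝ) ≤ n := by exact_mod_cast hn4
  have hd1 : (1 : ℝ) ≤ dcore := by exact_mod_cast Nat.one_le_iff_ne_zero.2 (NeZero.ne dcore)
  have hε0 : 0 < ε := (Real.rpow_pos_of_pos (by linarith) _).trans_le hεn
  have hlogε : (dcore : ℝ) ≤ Real.log ε⁻¹ := by
    rw [Real.log_inv, le_neg]
    exact (Real.log_le_iff_le_exp hε0).2 hεd
  have hNd : dcore ≤ numHashes α ε := by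
    have : (dcore : ℝ) ≤ numHashes α ε := by
      refine le_trans ?_ (Nat.le_ceil _)
      linarith
    exact_mod_cast this
  have hNdR : (dcore : ℝ) ≤ numHashes α ε := by exact_mod_cast hNd
  have hlast : 1 ≤ lastPhase α ε dcore :=
    (Nat.one_le_div_iff (Nat.pos_of_ne_zero (NeZero.ne dcore))).2 hNd
  have hlastN : (lastPhase α ε dcore : ℝ) ≤ numHashes α ε := by
    exact_mod_cast Nat.div_le_self _ _
  have hNup : (numHashes α ε : ℝ) < Real.log ε⁻¹ + α + 1 := Nat.ceil_lt_add_one (by linarith)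
  set N : ℝ := ((numHashes α ε : ℕ) : ℝ) with hN
  set c₀ : ℝ := α * (1 - α) / 16 with hc₀
  have hc₀0 : 0 < c₀ := by rw [hc₀]; exact div_pos (mul_pos hα0 (by linarith)) (by norm_num)
  have hc₀1 : c₀ ≤ α / 16 := by rw [hc₀]; nlinarith
  have hc₀2 : c₀ ≤ (1 - α) / 16 := by rw [hc₀]; nlinarith
  have hN1 : 1 ≤ N := hd1.trans hNdR
  set θ := thresholds n α ε εcore dcore with hθdef
  set η : ℝ := c₀ / N with hη
  have hη0 : 0 ≤ η := div_nonneg hc₀0.le (by linarith)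
  have hη1 : η ≤ c₀ := div_le_self hc₀0.le hN1
  have hηN : η * N = c₀ := by rw [hη]; field_simp
  have hlam0 : 0 ≤ η / N := div_nonneg hη0 (by linarith)
  have hlamη : η / N ≤ η := div_le_self hη0 hN1
  have h8n : 8 / (n : ℝ) * N ≤ c₀ := (mul_le_mul_of_nonneg_left hl (by positivity)).trans hln
  have hDq : ∀ q ∈ Finset.Icc 1 (lastPhase α ε dcore), (dMax α ε dcore q : ℝ) ≤ N := fun q hq =>
    Nat.cast_le.2 (dMax_le_numHashes (Finset.mem_Icc.1 hq).2)
  have hDd : ∀ q, 1 ≤ q → (dcore : ℝ) ≤ dMax α ε dcore q := fun q hq => by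
    exact_mod_cast dcore_le_dMax hq
  have hDJ : ∀ q, 1 ≤ q → (dMax α ε dcore q : ℝ) = preDepth α ε dcore q + dcore := fun q hq => by
    exact_mod_cast dMax_eq_preDepth_add hq
  -- Since `numHashes` < ln ε⁻¹ + α + 1, at least ε·n/e ≥ n^(3/4)/e slots are meant to stay free;
  -- this sets the scale of all deviations.
  have hexpN : ∀ D : ℝ, D ≤ N → Real.exp (-1) * (n : ℝ) ^ (3 / 4 : ℝ) ≤
      Real.exp (-D + α) * n := by
    intro D hD
    have e1 : (n : ℝ) ^ (3 / 4 : ℝ) = (n : ℝ) ^ (-(1 / 4) : ℝ) * n := by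
      nth_rewrite 3 [← Real.rpow_one (n : ℝ)]
      rw [← Real.rpow_add (by linarith)]; norm_num
    rw [e1, ← mul_assoc]
    refine mul_le_mul_of_nonneg_right ?_ (by linarith)
    calc Real.exp (-1) * (n : ℝ) ^ (-(1 / 4) : ℝ) ≤ Real.exp (-1) * ε := by gcongr
      _ = Real.exp (-1 + Real.log ε) := by rw [Real.exp_add, Real.exp_log hε0]
      _ ≤ _ := by
        refine Real.exp_le_exp.2 ?_
        rw [Real.log_inv] at hNup
        linarith
  have hgap1 : gapConst α εcore dcore ≤ Real.exp (-1) * (1 - Real.exp (-(α / 16))) :=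
    (min_le_left _ _).trans (min_le_left _ _)
  have hgap2 : gapConst α εcore dcore ≤ Real.exp (-1) * ((1 - α) / 2) :=
    (min_le_left _ _).trans (min_le_right _ _)
  have hgap3 : gapConst α εcore dcore ≤ Real.exp (-(dcore : ℝ) + α / 4) - εcore :=
    (min_le_right _ _).trans (min_le_left _ _)
  have hgap4 : gapConst α εcore dcore ≤ α / 8 := (min_le_right _ _).trans (min_le_right _ _)
  have hgap0 : 0 < gapConst α εcore dcore := gapConst_pos hα0 hα1 hεc
  have hn34 : (n : ℝ) ^ (3 / 4 : ℝ) ≤ n := by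
    conv_rhs => rw [← Real.rpow_one (n : ℝ)]
    exact Real.rpow_le_rpow_of_exponent_le (by linarith) (by norm_num)
  have hn34' : 0 ≤ (n : ℝ) ^ (3 / 4 : ℝ) := Real.rpow_nonneg (by linarith) _
  set gp := gapConst α εcore dcore with hgp
  have hvalid : θ.Valid (n := n) α ε dcore :=
    { two_le := by omega
      η_nonneg := hη0
      η_le := by change η ≤ 1; linarith
      lam_nonneg := hlam0
      lam_mul_le := by
        change η / N * N ≤ η
        rw [div_mul_cancel₀ _ (by linarith)]
      freeLo_le := fun q hq => by
        change _ ≤ if q + 1 ≤ 1 then (0 : ℝ) else _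
        rw [if_neg (by omega), preDepth_succ]
        have := Nat.le_ceil ((1 - Real.exp (-(dMax α ε dcore q : ℝ) + α)) * n)
        unfold target
        linarith }
  have hfree : ∀ q, 1 ≤ q → θ.freeHi q ≤ (n : ℝ) - target n α ε dcore q := fun q hq => by
    have hexp : Real.exp (-(dMax α ε dcore q : ℝ) + α) ≤ 1 :=
      Real.exp_le_one_iff.2 (by linarith [hDd q hq])
    have := Nat.ceil_lt_add_one (a := (1 - Real.exp (-(dMax α ε dcore q : ℝ) + α)) * n)
      (mul_nonneg (by linarith) (by linarith))
    change Real.exp (-(dMax α ε dcore q : ℝ) + α) * n - 1 ≤ _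
    unfold target
    linarith
  have hlen : ∀ q, 1 ≤ q →
      (θ.lenHi q : ℝ) + θ.weightHi ≤ preDepth α ε dcore q * n + θ.coreLen := fun q hq => by
    have e1 := Nat.ceil_lt_add_one (a := ((dMax α ε dcore q : ℝ) - 7 * α / 8) * n)
      (mul_nonneg (by linarith [hDd q hq]) (by linarith))
    have e2 := Nat.le_ceil (((dcore : ℝ) - α / 2) * n)
    change (⌈((dMax α ε dcore q : ℝ) - 7 * α / 8) * n⌉₊ : ℝ) + α / 4 * n ≤
      preDepth α ε dcore q * n + (⌈((dcore : ℝ) - α / 2) * n⌉₊ : ℝ)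
    rw [hDJ q hq] at e1 ⊢
    linarith
  -- The smaller rate η/N, used for the weights, serves as the common rate of all four events.
  set y : ℝ := η / N * (gp * (n : ℝ) ^ (3 / 4 : ℝ) - 1) with hy
  have hG0 : 0 ≤ gp * (n : ℝ) ^ (3 / 4 : ℝ) - 1 := by linarith
  have hexpo : ∀ u X : ℝ, η / N ≤ u → X ≤ -(gp * (n : ℝ) ^ (3 / 4 : ℝ) - 1) → u * X ≤ -y := by
    intro u X hu hX
    have : y ≤ u * (gp * (n : ℝ) ^ (3 / 4 : ℝ) - 1) := mul_le_mul_of_nonneg_right hu hG0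
    have := mul_le_mul_of_nonneg_left hX (hlam0.trans hu)
    linarith
  have b1 : ∀ q ∈ Finset.Icc 1 (lastPhase α ε dcore),
      θ.η * (θ.rho n ^ θ.lenHi q * n - θ.freeHi q) ≤ -y := fun q hq => by
    refine hexpo η _ hlamη ?_
    have hD := hDq q hq
    refine gap_hi (by omega) hα0 hη0 (by linarith) ?_ hn34' (hexpN _ hD) hgap1 (Nat.le_ceil _)
    exact le_trans (mul_le_mul_of_nonneg_left hD hη0) (by linarith)
  have b2 : ∀ q ∈ Finset.Icc 1 (lastPhase α ε dcore),
      θ.η * (θ.freeLo q - θ.sig n ^ ((preDepth α ε dcore q - dcore) * n) * n) ≤ -y := fun q hq => by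
    refine hexpo η _ hlamη ?_
    have hD := hDq q hq
    have hDJ' := hDJ q (Finset.mem_Icc.1 hq).1
    have hgn : gp * (n : ℝ) ^ (3 / 4 : ℝ) ≤ n := by
      calc gp * (n : ℝ) ^ (3 / 4 : ℝ) ≤ 1 * (n : ℝ) ^ (3 / 4 : ℝ) := by
            gcongr; linarith
        _ ≤ n := by rw [one_mul]; exact hn34
    by_cases hq1 : q ≤ 1
    · have : q = 1 := le_antisymm hq1 (Finset.mem_Icc.1 hq).1
      subst this
      have hJ0 : preDepth α ε dcore 1 - dcore = 0 := by
        unfold preDepth dMax gam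
        have := Nat.mod_lt (numHashes α ε) (Nat.pos_of_ne_zero (NeZero.ne dcore))
        omega
      change (if (1 : ℕ) ≤ 1 then (0 : ℝ) else
        Real.exp (-(preDepth α ε dcore 1 : ℝ) + α) * n) - _ ≤ _
      rw [if_pos le_rfl, hJ0, zero_mul, pow_zero]
      linarith
    · change (if q ≤ 1 then (0 : ℝ) else
        Real.exp (-(preDepth α ε dcore q : ℝ) + α) * n) - _ ≤ _
      rw [if_neg hq1]
      have hJd : dcore ≤ preDepth α ε dcore q := by
        obtain ⟨q', rfl⟩ : ∃ q', q = q' + 1 := ⟨q - 1, by omega⟩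
        rw [preDepth_succ]; exact dcore_le_dMax (by omega)
      have hJN : (preDepth α ε dcore q : ℝ) ≤ N := by linarith
      refine gap_lo hn4 hα1 hη0 (by linarith) hd1 ?_ ?_ hn34' (hexpN _ hJN) hgap2 ?_
      · exact le_trans (mul_le_mul_of_nonneg_left (by linarith : _ ≤ N) hη0) (by linarith)
      · exact le_trans (mul_le_mul_of_nonneg_left (by linarith : _ ≤ N) (by positivity))
          (h8n.trans hc₀2)
      · rw [Nat.cast_mul, Nat.cast_sub hJd]
  have hcl := Nat.ceil_lt_add_one (a := ((dcore : ℝ) - α / 2) * n)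
    (mul_nonneg (by linarith) (by linarith))
  have b3 : θ.η * (θ.unhitLo - θ.sig n ^ θ.coreLen * n) ≤ -y := by
    refine hexpo η _ hlamη ?_
    refine gap_unhit hn4 hη0 (by linarith) ?_ ?_ hn34 hgap0.le hgap3 ?_
    · exact le_trans (mul_le_mul_of_nonneg_left (by linarith : _ ≤ N) hη0) (by linarith)
    · exact le_trans (mul_le_mul_of_nonneg_left (by linarith : _ ≤ N) (by positivity))
        (h8n.trans hc₀1)
    · change (⌈((dcore : ℝ) - α / 2) * n⌉₊ : ℝ) ≤ _
      linarith
  have b4 : θ.lam * (θ.rho n ^ θ.coreLen * (dcore * n) - θ.weightHi) ≤ -y := by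
    refine hexpo (η / N) _ le_rfl ?_
    refine gap_weight (by omega) hα0 hη0 (by linarith) hd1 ?_ h1 hn34' hn34 hgap4 (Nat.le_ceil _)
    exact le_trans (mul_le_mul_of_nonneg_left hNdR hη0) (by linarith)
  have hmain := Thresholds.one_sub_pot_le hvalid hlast L hfree hlen
  have hpot := Thresholds.pot_init_le hvalid b1 b2 b3 b4
  have hyl : c₀ / l / l * (gp * (n : ℝ) ^ (3 / 4 : ℝ) - 1) ≤ y := by
    rw [hy, hη]
    refine mul_le_mul_of_nonneg_right ?_ hG0
    have hl0 : 0 < l := by linarith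
    gcongr
  have hfin : (lastPhase α ε dcore : ℝ) * (4 * Real.exp (-y)) ≤
      l * (4 * Real.exp (-(c₀ / l / l * (gp * (n : ℝ) ^ (3 / 4 : ℝ) - 1)))) := by
    have hl0 : 0 < l := by linarith
    gcongr
    exact hlastN.trans hl
  have hset : (n : ℝ) + 1 - θ.unhitLo = (1 - εcore) * n := by
    change (n : ℝ) + 1 - (εcore * n + 1) = _
    ring
  rw [hset] at hmain
  linarith

end

/-! ### Asymptotics of the failure probability -/

theorem eventually_log_add_le (δ r : ℝ) (hδ : 0 < δ) (hr : 0 < r) :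
    ∀ᶠ n : ℕ in Filter.atTop, Real.log n + 3 ≤ δ * (n : ℝ) ^ r := by
  have h1 : ∀ᶠ x : ℝ in Filter.atTop, ‖Real.log x‖ ≤ δ / 2 * ‖x ^ r‖ :=
    (isLittleO_log_rpow_atTop hr).bound (half_pos hδ)
  have h2 : ∀ᶠ x : ℝ in Filter.atTop, 3 / (δ / 2) ≤ x ^ r :=
    (tendsto_rpow_atTop hr).eventually_ge_atTop _
  filter_upwards [tendsto_natCast_atTop_atTop.eventually h1,
    tendsto_natCast_atTop_atTop.eventually h2] with n hn1 hn2
  rw [div_le_iff₀ (half_pos hδ)] at hn2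
  have := (le_abs_self _).trans hn1
  rw [Real.norm_of_nonneg (Real.rpow_nonneg (Nat.cast_nonneg _) _)] at this
  linarith

theorem eventually_failure_small {c c₀ gp : ℝ} (hc : 0 < c) (hc₀ : 0 < c₀) (hgp : 0 < gp) :
    ∀ᶠ n : ℕ in Filter.atTop, 8 / (n : ℝ) * (Real.log n + 3) ≤ c₀ ∧
      1 ≤ gp * (n : ℝ) ^ (3 / 4 : ℝ) ∧
      (Real.log n + 3) * (4 * Real.exp (-(c₀ / (Real.log n + 3) / (Real.log n + 3) *
        (gp * (n : ℝ) ^ (3 / 4 : ℝ) - 1)))) ≤ 1 / (n : ℝ) ^ c := by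
  -- With l = log n + 3 ≤ δ·n^(1/4), the cube is at most δ·n^(3/4) since δ ≤ 1. The other bound on δ
  -- makes the exponent at least (4+c)l, where 4l absorbs the prefactor 4l.
  set δ : ℝ := min 1 (c₀ * gp / 2 / (4 + c)) with hδ
  have hδ0 : 0 < δ := lt_min one_pos (by positivity)
  have h34 : ∀ᶠ x : ℝ in Filter.atTop, 2 / gp ≤ x ^ (3 / 4 : ℝ) :=
    (tendsto_rpow_atTop (by norm_num)).eventually_ge_atTop _
  filter_upwards [eventually_log_add_le (c₀ / 8) 1 (by positivity) one_pos,
    eventually_log_add_le δ (1 / 4) hδ0 (by norm_num),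
    tendsto_natCast_atTop_atTop.eventually h34, Filter.eventually_ge_atTop 1] with n h1 h2 h3 hn
  have hnR : (1 : ℝ) ≤ n := by exact_mod_cast hn
  have hlog : 0 ≤ Real.log n := Real.log_nonneg hnR
  set l : ℝ := Real.log n + 3 with hl
  have hl3 : 3 ≤ l := by linarith
  rw [div_le_iff₀ hgp] at h3
  rw [Real.rpow_one] at h1
  refine ⟨?_, by linarith, ?_⟩
  · rw [div_mul_eq_mul_div, div_le_iff₀ (by linarith)]
    linarith
  · have hcube : l ^ 3 ≤ δ * (n : ℝ) ^ (3 / 4 : ℝ) := by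
      have e : ((n : ℝ) ^ (1 / 4 : ℝ)) ^ 3 = (n : ℝ) ^ (3 / 4 : ℝ) := by
        rw [← Real.rpow_natCast, ← Real.rpow_mul (by linarith)]; norm_num
      calc l ^ 3 ≤ (δ * (n : ℝ) ^ (1 / 4 : ℝ)) ^ 3 := by gcongr
        _ = δ ^ 3 * (n : ℝ) ^ (3 / 4 : ℝ) := by rw [mul_pow, e]
        _ ≤ δ * (n : ℝ) ^ (3 / 4 : ℝ) := by
          gcongr
          exact pow_le_of_le_one hδ0.le (min_le_left _ _) (by norm_num)
    have hδc : (4 + c) * δ ≤ c₀ * gp / 2 := by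
      have : δ ≤ c₀ * gp / 2 / (4 + c) := min_le_right _ _
      rw [le_div_iff₀ (by linarith)] at this
      linarith
    have hY : (4 + c) * l ≤ c₀ / l / l * (gp * (n : ℝ) ^ (3 / 4 : ℝ) - 1) := by
      rw [div_div, div_mul_eq_mul_div, le_div_iff₀ (by positivity)]
      have hp : 0 ≤ (n : ℝ) ^ (3 / 4 : ℝ) := Real.rpow_nonneg (by linarith) _
      calc (4 + c) * l * (l * l) = (4 + c) * l ^ 3 := by ring
        _ ≤ (4 + c) * (δ * (n : ℝ) ^ (3 / 4 : ℝ)) := by gcongr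
        _ = (4 + c) * δ * (n : ℝ) ^ (3 / 4 : ℝ) := by ring
        _ ≤ c₀ * gp / 2 * (n : ℝ) ^ (3 / 4 : ℝ) := by gcongr
        _ = c₀ * (gp * (n : ℝ) ^ (3 / 4 : ℝ) / 2) := by ring
        _ ≤ _ := by gcongr; linarith
    have h4l : l * 4 ≤ Real.exp (4 * l) := by
      linarith [Real.add_one_le_exp (4 * l)]
    calc l * (4 * Real.exp (-(c₀ / l / l * (gp * (n : ℝ) ^ (3 / 4 : ℝ) - 1))))
        = l * 4 * Real.exp (-(c₀ / l / l * (gp * (n : ℝ) ^ (3 / 4 : ℝ) - 1))) := by ring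
      _ ≤ Real.exp (4 * l) * Real.exp (-((4 + c) * l)) := by gcongr
      _ = Real.exp (-(c * l)) := by rw [← Real.exp_add]; congr 1; ring
      _ ≤ Real.exp (-(c * Real.log n)) := by gcongr; linarith
      _ = 1 / (n : ℝ) ^ c := by
        rw [Real.rpow_def_of_pos (by linarith), one_div, ← Real.exp_neg]
        congr 1; ring

end BubbleUp

/-! ### The proposition -/

theorem proposition4p3
    (α : ℝ) (hα0 : 0 < α) (hα1 : α < 1)
    (dcore : ℕ) [NeZero dcore] (εcore : ℝ) (hε0 : 0 < εcore)
    (h1 : ∀ j : ℕ, dcore ≤ j → (j : ℝ) / Real.exp ((j : ℝ) - α) ≤ α / 8)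
    (h2 : Real.log εcore⁻¹ + α / 8 > (dcore : ℝ) * (1 + εcore))
    (h3 : εcore < 1 / 2)
    (L : ℕ → ℕ) (c : ℝ) (hc : 0 < c) :
    ∃ C : ℝ, ∀ (n : ℕ) [NeZero n] (ε : ℝ),
      (n : ℝ) ^ (-(1 / 4) : ℝ) ≤ ε → ε ≤ Real.exp (-(dcore : ℝ)) →
      1 - C / (n : ℝ) ^ c ≤
        (BubbleUp.law n dcore).real
          {ω | ∀ t : ℕ, (BubbleUp.run α ε (L n) ω t).AtPhaseEnd α ε dcore →
            ((BubbleUp.run α ε (L n) ω t).coreCount α ε dcore : ℝ) ≤ (1 - εcore) * n} := by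
  have hεc : εcore < Real.exp (-(dcore : ℝ) + α / 8) := by
    rw [← Real.log_lt_iff_lt_exp hε0]
    rw [Real.log_inv] at h2
    have : 0 ≤ (dcore : ℝ) * εcore := mul_nonneg (Nat.cast_nonneg _) hε0.le
    linarith
  have hgp := BubbleUp.gapConst_pos hα0 hα1 hεc
  have hc₀ : 0 < α * (1 - α) / 16 := div_pos (mul_pos hα0 (by linarith)) (by norm_num)
  obtain ⟨N, hN⟩ := Filter.eventually_atTop.1
    ((BubbleUp.eventually_failure_small hc hc₀ hgp).and
      ((Filter.eventually_ge_atTop 4).and (Filter.eventually_ge_atTop ⌈8 / α⌉₊)))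
  -- For n < N this constant makes the claimed lower bound at most 0; from N on, the asymptotic
  -- estimates apply.
  refine ⟨max 1 ((N : ℝ) ^ c), fun n _ ε hεn hεd => ?_⟩
  have hn1 : (1 : ℝ) ≤ n := by exact_mod_cast Nat.one_le_iff_ne_zero.2 (NeZero.ne n)
  have hnc : 0 < (n : ℝ) ^ c := Real.rpow_pos_of_pos (by linarith) _
  by_cases hnN : N ≤ n
  · obtain ⟨⟨hln, hgap, hfail⟩, hn4, hnα⟩ := hN n hnN
    have hnα' : 8 ≤ α * n := by
      have : 8 / α ≤ n := (Nat.le_ceil _).trans (by exact_mod_cast hnα)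
      rw [div_le_iff₀ hα0] at this
      linarith
    -- From ε ≥ n^(-1/4), ln ε⁻¹ ≤ (log n)/4, and rounding up adds less than α + 1 < 3.
    have hl : (BubbleUp.numHashes α ε : ℝ) ≤ Real.log n + 3 := by
      have hε : 0 < ε := (Real.rpow_pos_of_pos (by linarith) _).trans_le hεn
      have hlog : -(1 / 4) * Real.log n ≤ Real.log ε := by
        rw [← Real.log_rpow (by linarith)]
        exact Real.log_le_log (Real.rpow_pos_of_pos (by linarith) _) hεn
      have hlε : 0 ≤ Real.log ε⁻¹ := by
        rw [Real.log_inv, le_neg, neg_zero]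
        refine ((Real.log_le_iff_le_exp hε).2 hεd).trans ?_
        exact neg_nonpos.2 (Nat.cast_nonneg _)
      have hceil : (BubbleUp.numHashes α ε : ℝ) < Real.log ε⁻¹ + α + 1 :=
        Nat.ceil_lt_add_one (by linarith)
      rw [Real.log_inv] at hceil
      linarith [Real.log_nonneg hn1]
    have hmain := BubbleUp.failure_le hα0 hα1 (h1 dcore le_rfl) hεc hεn hεd hl hn4 hnα' hln hgap
      (L n)
    have hprob : IsProbabilityMeasure (BubbleUp.law n dcore) := by
      unfold BubbleUp.law; infer_instance
    have hsub := measureReal_mono (μ := BubbleUp.law n dcore)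
      (s₁ := {ω | ∀ t : ℕ,
        ((BubbleUp.run α ε (L n) ω t).coreCount α ε dcore : ℝ) ≤ (1 - εcore) * n})
      (s₂ := {ω | ∀ t : ℕ, (BubbleUp.run α ε (L n) ω t).AtPhaseEnd α ε dcore →
        ((BubbleUp.run α ε (L n) ω t).coreCount α ε dcore : ℝ) ≤ (1 - εcore) * n})
      (fun ω hω t _ => hω t)
    have hC : 1 / (n : ℝ) ^ c ≤ max 1 ((N : ℝ) ^ c) / (n : ℝ) ^ c := by
      gcongr; exact le_max_left _ _
    linarith
  · have hC : 1 ≤ max 1 ((N : ℝ) ^ c) / (n : ℝ) ^ c := by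
      rw [le_div_iff₀ hnc, one_mul]
      refine le_trans ?_ (le_max_right _ _)
      have : (n : ℝ) ≤ N := by exact_mod_cast (not_le.1 hnN).le
      gcongr
    have : 0 ≤ (BubbleUp.law n dcore).real
      {ω | ∀ t : ℕ, (BubbleUp.run α ε (L n) ω t).AtPhaseEnd α ε dcore →
        ((BubbleUp.run α ε (L n) ω t).coreCount α ε dcore : ℝ) ≤ (1 - εcore) * n} :=
      measureReal_nonneg
    linarith
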